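/- Let $\mathbb{C}^n$ carry its canonical complex structure $J$ and canonical (flat) metric $can$, with gradient, Laplacian $\Delta=\mathrm{trace}\,\nabla d$ and norm taken with respect to $can$; the real dimension is $m=2n$. For $\alpha\in\mathbb{R}^n$ put $q_\alpha(z)=\sum_{k=1}^n\frac{\alpha_k}{2}|z_k|^2$. For a real function $q$, put $\Gamma_n(q)=\frac{1}{n-3}\ln q$ if $n\ne 3$ (where $q>0$) and $\Gamma_3(q)=q$. Consider the equation $$\Delta\gamma+\tfrac{m-2}{2}\,|\mathrm{grad}\,\gamma|^2=0.\qquad(*)$$ 1. Let $U\subseteq\mathbb{C}^n$ be a connected nonempty open set and $\gamma:U\to\mathbb{R}$ smooth. Then $J(e^{(n-3)\gamma}\,\mathrm{grad}\,\gamma)$ is a Killing vector field on $U$ if and only if there are a unitary transformation $W$ of $\mathbb{C}^n$, $\alpha\in\mathbb{R}^n$, $b\in\mathbb{C}^n$ and $c\in\mathbb{R}$ with $\gamma=\Gamma_n(q)$ on $U$, where $q(z)=q_\alpha(Wz)+\mathrm{Re}\langle b,z\rangle+c$ (and $q>0$ on $U$ if $n\neq3$). 2. Let $n\ge 2$, $0\ne\alpha\in\mathbb{R}^n$,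 and let $U\subseteq\mathbb{C}^n$ be a nonempty open set, with $q_\alpha>0$ on $U$ if $n\ne3$. Then for $\gamma=\Gamma_n(q_\alpha)$ the field $J(e^{(n-3)\gamma}\,\mathrm{grad}\,\gamma)$ is Killing on $U$, and $\gamma$ satisfies $(*)$ on $U$ if and only if $n=2$ and $\alpha_1=\alpha_2$. 3. Let $n\ge2$, let $U\subseteq\mathbb{C}^n$ be a connected nonempty open set and $\gamma:U\to\mathbb{R}$ a nonconstant smooth function. Then $J(e^{(n-3)\gamma}\,\mathrm{grad}\,\gamma)$ is Killing and $\gamma$ satisfies $(*)$ on $U$ if and only if $n=2$ and there are $\alpha>0$ and $a\in\mathbb{C}^2\setminus U$ such that $\gamma(z)=-\ln\left(\frac{\alpha}{2}|z-a|^2\right)$ on $U$. 4. Let $(N,h,J^N)$ be a (finite-dimensional, smooth) almost Hermitian manifold which is $(1,2)$-symplectic, i.e. $(\nabla_XJ^N)Y+(\nabla_{J^NX}J^N)(J^NY)=0$ for all $X,Y$, with $\nabla$ the Levi-Civita connection of $h$. Then every holomorphic map $\varphi:(\mathbb{C}^2\setminus\{0\},|z|^{-4}can)\to N$ (i.e.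 smooth with $d\varphi\circ J=J^N\circ d\varphi$) is biharmonic, i.e. its bitension field $$\tau_2(\varphi)=\mathrm{trace}(\nabla^\varphi)^2\tau(\varphi)+\sum_iR^N(\tau(\varphi),d\varphi(e_i))d\varphi(e_i)$$ vanishes, where $\tau(\varphi)=\mathrm{trace}\,\nabla d\varphi$, $\{e_i\}$ is a local orthonormal frame, and $R(X,Y)Z=\nabla_X\nabla_YZ-\nabla_Y\nabla_XZ-\nabla_{[X,Y]}Z$. -/

import Mathlib

open scoped Manifold ContDiff Gradient Laplacian Bundle

noncomputable section

namespace BiharmonicExample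

/-! ### Riemannian geometry in linear coordinates

A (pseudo-)metric on an open subset of a finite-dimensional real normed space `E` is a field
`g : E → E →L[ℝ] E →L[ℝ] ℝ`.  All the objects below are germ-local: their value at a point depends
only on the fields near that point. -/

section Coordinates

variable {E : Type*} [NormedAddCommGroup E] [NormedSpace ℝ E]
variable {F : Type*} [NormedAddCommGroup F] [NormedSpace ℝ F]

/-- The constant (flat) metric of a Euclidean space. -/
def flatMetric (E : Type*) [NormedAddCommGroup E] [InnerProductSpace ℝ E] :
    E → E →L[ℝ] E →L[ℝ] ℝ :=
  fun _ => innerSL ℝ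

/-- The Christoffel map `Γ_x(v, w)` of the metric `g`, determined by
`2 g(Γ(v, w), u) = D_v g (w, u) + D_w g (v, u) - D_u g (v, w)`. -/
def christoffel (g : E → E →L[ℝ] E →L[ℝ] ℝ) (x v w : E) : E :=
  (g x).inverse ((1 / 2 : ℝ) •
    (fderiv ℝ g x v w + fderiv ℝ g x w v - fderiv ℝ (fun y => g y v w) x))

/-- The Riemann curvature tensor `R(u, v) w`, with the convention
`R(X, Y) Z = ∇_X ∇_Y Z - ∇_Y ∇_X Z - ∇_[X, Y] Z`. -/
def curvature (g : E → E →L[ℝ] E →L[ℝ] ℝ) (x u v w : E) : E :=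
  fderiv ℝ (fun y => christoffel g y v w) x u - fderiv ℝ (fun y => christoffel g y u w) x v
    + christoffel g x u (christoffel g x v w) - christoffel g x v (christoffel g x u w)

/-- The trace `∑ g^{ij} B(b_i, b_j)` of a bilinear map `B` with respect to the metric at `x`,
that is `∑ B(e_i, e_i)` for any basis `e_i` orthonormal with respect to `g x`.  The vector
`(g x).inverse (b^i)` is the one which represents the `i`-th coordinate functional. -/
def metricTrace [FiniteDimensional ℝ E] (g : E → E →L[ℝ] E →L[ℝ] ℝ) (x : E) (B : E → E → F) : F :=
  ∑ i, B (Module.finBasis ℝ E i)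
    ((g x).inverse (LinearMap.toContinuousLinearMap ((Module.finBasis ℝ E).coord i)))

/-- The pull-back connection `∇^u_v V` on sections `V` of `u⁻¹ T F`, for a map `u : E → F` and the
Levi-Civita connection of the metric `h` on the target. -/
def pullbackConn (h : F → F →L[ℝ] F →L[ℝ] ℝ) (u : E → F) (V : E → F) (x v : E) : F :=
  fderiv ℝ V x v + christoffel h (u x) (fderiv ℝ u x v) (V x)

/-- The second fundamental form `∇du(v, w) = ∇^u_v (du w) - du (∇_v w)`. -/
def secondFundForm (g : E → E →L[ℝ] E →L[ℝ] ℝ) (h : F → F →L[ℝ] F →L[ℝ] ℝ) (u : E → F)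
    (x v w : E) : F :=
  pullbackConn h u (fun y => fderiv ℝ u y w) x v - fderiv ℝ u x (christoffel g x v w)

/-- The tension field `τ(u) = tr ∇du`. -/
def tension [FiniteDimensional ℝ E] (g : E → E →L[ℝ] E →L[ℝ] ℝ) (h : F → F →L[ℝ] F →L[ℝ] ℝ)
    (u : E → F) (x : E) : F :=
  metricTrace g x (secondFundForm g h u x)

/-- The rough Laplacian `tr (∇^u)² V = ∑ ∇^u_{e_i} ∇^u_{e_i} V - ∇^u_{∇_{e_i} e_i} V`. -/
def roughLaplacian [FiniteDimensional ℝ E] (g : E → E →L[ℝ] E →L[ℝ] ℝ)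
    (h : F → F →L[ℝ] F →L[ℝ] ℝ) (u : E → F) (V : E → F) (x : E) : F :=
  metricTrace g x (fun v w =>
    pullbackConn h u (fun y => pullbackConn h u V y w) x v
      - pullbackConn h u V x (christoffel g x v w))

/-- The operator `Ric^u V = ∑ R^h(V, du(e_i)) du(e_i)`. -/
def ricciAlong [FiniteDimensional ℝ E] (g : E → E →L[ℝ] E →L[ℝ] ℝ)
    (h : F → F →L[ℝ] F →L[ℝ] ℝ) (u : E → F) (V : E → F) (x : E) : F :=
  metricTrace g x (fun v w => curvature h (u x) (V x) (fderiv ℝ u x v) (fderiv ℝ u x w))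

/-- The bitension field `τ₂(u) = (tr (∇^u)² + Ric^u)(τ(u))`. -/
def bitension [FiniteDimensional ℝ E] (g : E → E →L[ℝ] E →L[ℝ] ℝ) (h : F → F →L[ℝ] F →L[ℝ] ℝ)
    (u : E → F) (x : E) : F :=
  roughLaplacian g h u (tension g h u) x + ricciAlong g h u (tension g h u) x

/-- `X` is a (smooth) Killing vector field of the metric `g` on the open set `U`: the Lie
derivative `(L_X g)(v, w) = (D_X g)(v, w) + g(D_v X, w) + g(v, D_w X)` vanishes on `U`. -/
def IsKillingOn (g : E → E →L[ℝ] E →L[ℝ] ℝ) (U : Set E) (X : E → E) : Prop :=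
  ContDiffOn ℝ ∞ X U ∧ ∀ x ∈ U, ∀ v w : E,
    fderiv ℝ g x (X x) v w + g x (fderiv ℝ X x v) w + g x v (fderiv ℝ X x w) = 0

end Coordinates

/-! ### Almost Hermitian manifolds -/

section Manifolds

variable (F : Type*) [NormedAddCommGroup F] [NormedSpace ℝ F]
variable (N : Type*) [TopologicalSpace N] [ChartedSpace F N] [IsManifold 𝓘(ℝ, F) ∞ N]

/-- An almost Hermitian structure on the manifold `N`: a smooth Riemannian metric `h` together with
a smooth almost complex structure `J` which is orthogonal for `h`. -/
structure AlmostHermitian where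
  /-- the Riemannian metric -/
  metric : Bundle.ContMDiffRiemannianMetric 𝓘(ℝ, F) ∞ F (fun x : N => TangentSpace 𝓘(ℝ, F) x)
  /-- the almost complex structure -/
  J : ∀ x : N, TangentSpace 𝓘(ℝ, F) x →L[ℝ] TangentSpace 𝓘(ℝ, F) x
  contMDiff_J : ContMDiff 𝓘(ℝ, F) (𝓘(ℝ, F).prod 𝓘(ℝ, F →L[ℝ] F)) ∞
    (fun x : N => Bundle.TotalSpace.mk' (F →L[ℝ] F)
      (E := fun x : N => TangentSpace 𝓘(ℝ, F) x →L[ℝ] TangentSpace 𝓘(ℝ, F) x) x (J x))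
  J_sq : ∀ (x : N) (v : TangentSpace 𝓘(ℝ, F) x), J x (J x v) = -v
  metric_J : ∀ (x : N) (v w : TangentSpace 𝓘(ℝ, F) x),
    metric.inner x (J x v) (J x w) = metric.inner x v w

variable {F N}

/-- The expression in a chart `e` of a Riemannian metric on `N`. -/
def chartMetric
    (h : Bundle.ContMDiffRiemannianMetric 𝓘(ℝ, F) ∞ F (fun x : N => TangentSpace 𝓘(ℝ, F) x))
    (e : OpenPartialHomeomorph N F) (y : F) : F →L[ℝ] F →L[ℝ] ℝ :=
  let D : F →L[ℝ] F := mfderiv 𝓘(ℝ, F) 𝓘(ℝ, F) e.symm y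
  let B : F →L[ℝ] F →L[ℝ] ℝ := h.inner (e.symm y)
  B.bilinearComp D D

/-- The expression in a chart `e` of a field of endomorphisms of the tangent spaces of `N`. -/
def chartEndo (J : ∀ x : N, TangentSpace 𝓘(ℝ, F) x →L[ℝ] TangentSpace 𝓘(ℝ, F) x)
    (e : OpenPartialHomeomorph N F) (y : F) : F →L[ℝ] F :=
  let D : F →L[ℝ] F := mfderiv 𝓘(ℝ, F) 𝓘(ℝ, F) e.symm y
  let D' : F →L[ℝ] F := mfderiv 𝓘(ℝ, F) 𝓘(ℝ, F) e (e.symm y)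
  let A : F →L[ℝ] F := J (e.symm y)
  D'.comp (A.comp D)

/-- The covariant derivative `(∇_v A) w` of an endomorphism field `A`, in linear coordinates. -/
def covDerivEndo (g : F → F →L[ℝ] F →L[ℝ] ℝ) (A : F → F →L[ℝ] F) (y v w : F) : F :=
  fderiv ℝ A y v w + christoffel g y v (A y w) - A y (christoffel g y v w)

/-- An almost Hermitian manifold is `(1,2)`-symplectic (the class `W₁ ⊕ W₂` of Gray and Hervella):
`(∇_X J) Y + (∇_{JX} J) (JY) = 0` for all `X`, `Y`; equivalently, `∇_{Z̄} W` is of type `(1,0)`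
whenever `Z` and `W` are, or again `(dΩ)^{1,2} = 0`. -/
def AlmostHermitian.IsOneTwoSymplectic (S : AlmostHermitian F N) : Prop :=
  ∀ e ∈ atlas F N, ∀ y ∈ e.target, ∀ v w : F,
    covDerivEndo (chartMetric S.metric e) (chartEndo S.J e) y v w
      + covDerivEndo (chartMetric S.metric e) (chartEndo S.J e) y
          (chartEndo S.J e y v) (chartEndo S.J e y w) = 0

/-- A map `φ` from the open subset `U` of a complex vector space into an almost complex manifold is
holomorphic: it is smooth and `dφ(i v) = J dφ(v)`. -/
def IsHolomorphicMapOn {E : Type*} [NormedAddCommGroup E] [NormedSpace ℝ E] [Module ℂ E]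
    (J : ∀ x : N, TangentSpace 𝓘(ℝ, F) x →L[ℝ] TangentSpace 𝓘(ℝ, F) x)
    (U : Set E) (φ : E → N) : Prop :=
  ContMDiffOn 𝓘(ℝ, E) 𝓘(ℝ, F) ∞ φ U ∧ ∀ z ∈ U, ∀ v : E,
    (mfderiv 𝓘(ℝ, E) 𝓘(ℝ, F) φ z : E →L[ℝ] TangentSpace 𝓘(ℝ, F) (φ z)) (Complex.I • v)
      = J (φ z) ((mfderiv 𝓘(ℝ, E) 𝓘(ℝ, F) φ z : E →L[ℝ] TangentSpace 𝓘(ℝ, F) (φ z)) v)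

/-- The smooth map `φ` from the Riemannian manifold `(U, g)`, where `U` is an open subset of `E`,
into the Riemannian manifold `(N, h)` is biharmonic: its bitension field vanishes. -/
def IsBiharmonicOn {E : Type*} [NormedAddCommGroup E] [NormedSpace ℝ E] [FiniteDimensional ℝ E]
    (g : E → E →L[ℝ] E →L[ℝ] ℝ) (U : Set E)
    (h : Bundle.ContMDiffRiemannianMetric 𝓘(ℝ, F) ∞ F (fun x : N => TangentSpace 𝓘(ℝ, F) x))
    (φ : E → N) : Prop :=
  ContMDiffOn 𝓘(ℝ, E) 𝓘(ℝ, F) ∞ φ U ∧ ∀ z ∈ U, ∀ e ∈ atlas F N, φ z ∈ e.source →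
    bitension g (chartMetric h e) (fun x => e (φ x)) z = 0

end Manifolds

/-! ### Complex Euclidean space -/

/-- The space `ℂⁿ` with its canonical Hermitian norm. -/
abbrev Cn (n : ℕ) := EuclideanSpace ℂ (Fin n)

/-- The quadratic form `∑ (α_k / 2) |z_k|²`. -/
def quad {n : ℕ} (α : Fin n → ℝ) (z : Cn n) : ℝ := ∑ k, α k / 2 * ‖z k‖ ^ 2

/-- The vector field `J (e^{(n-3)γ} grad γ)` on `ℂⁿ`. -/
def twistedGrad {n : ℕ} (γ : Cn n → ℝ) (z : Cn n) : Cn n :=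
  Complex.I • (Real.exp (((n : ℝ) - 3) * γ z) • ∇ γ z)

/-- The equation `Δγ + ((m - 2) / 2) |grad γ|² = 0` on `U ⊆ ℂⁿ`, where `m = 2n` is the real
dimension. -/
def SolvesOn {n : ℕ} (U : Set (Cn n)) (γ : Cn n → ℝ) : Prop :=
  ∀ z ∈ U, Δ γ z + ((2 * (n : ℝ) - 2) / 2) * ‖∇ γ z‖ ^ 2 = 0

/-- The function `(1 / (n - 3)) ln q` when `n ≠ 3`, and `q` itself when `n = 3`. -/
def potential (n : ℕ) (q : Cn n → ℝ) (z : Cn n) : ℝ :=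
  if n = 3 then q z else 1 / ((n : ℝ) - 3) * Real.log (q z)

/-- The metric `|z|⁻⁴ can` on `ℂ² ∖ {0}`. -/
def invMetric : Cn 2 → Cn 2 →L[ℝ] Cn 2 →L[ℝ] ℝ :=
  fun z => (‖z‖ ^ 4)⁻¹ • flatMetric (Cn 2) z

end BiharmonicExample

end

open BiharmonicExample

set_option maxSynthPendingDepth 3

/-! For the flat statements, put q = e^{(n-3)γ} (q = γ if n = 3). Then e^{(n-3)γ} grad γ is a
nonzero constant multiple of grad q. A Killing field of a flat metric is affine, so if J grad q is
Killing, the Hessian H of q is constant on a connected set. Skewness of JH together with symmetry of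
H means that H commutes with J. So H is Hermitian, a unitary W diagonalizes it, and q is the stated
polynomial; the converse is direct (`isKillingOn_twistedGrad_iff`).

In terms of q, (*) reads (n-3) q Δq + 2|grad q|² = 0 (Δq + 2|grad q|² = 0 if n = 3), an identity
between polynomials on an open set. Its quadratic part forces each α_k to be 0 or (3-n)S/2, where S
is the sum of the α_k. If L of them are nonzero, then L(3-n) = 2, so n = L = 2 once n ≥ 2. The
constant term then makes q a complete square (`solution_coefficients`, `hermPoly_const_eq`).

For the biharmonic statement, holomorphy and the (1,2)-symplectic condition are used only to show
that φ is harmonic for the flat metric (`harmonic_of_holomorphic`). Let Z = dφ(x) be the image of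
the position field. Dilations preserve flat harmonicity, so Z is a Jacobi field along φ
(`jacobi_radialPush`). For |z|⁻⁴ can the tension field is fZ with f = -4|x|². The conformal
Laplacian is |x|⁴ times the flat one minus ∇ in the direction 4x/|x|². Its first-order term cancels
the terms in which the flat Laplacian differentiates f, leaving |x|⁴ f times the Jacobi operator of
Z, which is zero (`bitension_invMetric_eq_zero`). -/

theorem two_le_infty : (2 : WithTop ℕ∞) ≤ ∞ := by
  exact WithTop.coe_le_coe.2 (le_top : (2 : ℕ∞) ≤ ⊤)

open InnerProductSpace in
/-- The gradient of a smooth function is smooth. -/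
theorem ContDiffAt.gradient_top {E : Type*} [NormedAddCommGroup E] [InnerProductSpace ℝ E]
    [CompleteSpace E] {f : E → ℝ} {z : E} (hf : ContDiffAt ℝ ∞ f z) : ContDiffAt ℝ ∞ (∇ f) z := by
  have h : ContDiffAt ℝ ∞ (fderiv ℝ f) z := hf.fderiv_right (m := ∞) (by simp)
  exact ((toDual ℝ E).symm.toContinuousLinearEquiv.contDiff.contDiffAt).comp z h

/-! ### Killing fields of a flat metric. -/

section FlatKilling

variable {E : Type*} [NormedAddCommGroup E] [InnerProductSpace ℝ E]

theorem isKillingOn_flatMetric_iff {U : Set E} {X : E → E} :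
    IsKillingOn (flatMetric E) U X ↔ ContDiffOn ℝ ∞ X U ∧
      ∀ x ∈ U, ∀ v w, inner ℝ (fderiv ℝ X x v) w + inner ℝ v (fderiv ℝ X x w) = 0 := by
  have h : ∀ x, fderiv ℝ (flatMetric E) x = 0 := fun x => by
    unfold flatMetric; simp
  simp only [IsKillingOn, h]
  simp only [zero_apply, zero_add]
  exact Iff.rfl

/-- A Killing field of a flat metric is affine: its derivative is locally constant. -/
theorem fderiv_fderiv_eq_zero_of_killing {U : Set E} (hU : IsOpen U) {X : E → E}
    (hX : IsKillingOn (flatMetric E) U X) {x : E} (hx : x ∈ U) :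
    fderiv ℝ (fderiv ℝ X) x = 0 := by
  rw [isKillingOn_flatMetric_iff] at hX
  obtain ⟨hs, hk⟩ := hX
  have hc : ContDiffAt ℝ ∞ X x := hs.contDiffAt (hU.mem_nhds hx)
  have hd : DifferentiableAt ℝ (fderiv ℝ X) x :=
    (hc.fderiv_right (m := ∞) (by simp)).differentiableAt (by simp)
  have hsym : ∀ u v, fderiv ℝ (fderiv ℝ X) x u v = fderiv ℝ (fderiv ℝ X) x v u := fun u v =>
    (hc.isSymmSndFDerivAt (by simpa using two_le_infty)).eq u v
  have hskew : ∀ u v w, inner ℝ (fderiv ℝ (fderiv ℝ X) x u v) w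
      + inner ℝ v (fderiv ℝ (fderiv ℝ X) x u w) = 0 := by
    intro u v w
    have h0 : (fun y => inner ℝ (fderiv ℝ X y v) w + inner ℝ v (fderiv ℝ X y w))
        =ᶠ[nhds x] fun _ => (0 : ℝ) := by
      filter_upwards [hU.mem_nhds hx] with y hy using hk y hy v w
    have hv : ∀ v, HasFDerivAt (fun y => fderiv ℝ X y v)
        ((fderiv ℝ (fderiv ℝ X) x).flip v) x := fun v => by
      simpa using hd.hasFDerivAt.clm_apply (hasFDerivAt_const v x)
    have h1 := (((hv v).inner ℝ (hasFDerivAt_const w x)).add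
      ((hasFDerivAt_const v x).inner ℝ (hv w)))
    have h2 := h1.unique (((hasFDerivAt_const (0 : ℝ) x)).congr_of_eventuallyEq h0)
    have h3 := congrArg (fun L => L u) h2
    simpa [real_inner_comm] using h3
  -- The trilinear form ⟨T u v, w⟩ is symmetric in u, v and skew in v, w; going round the
  -- permutations shows that it equals its own negative.
  set T := fderiv ℝ (fderiv ℝ X) x
  ext u v
  refine ext_inner_right ℝ fun w => ?_
  have a : ∀ u v w, inner ℝ (T u v) w = - inner ℝ (T u w) v := fun u v w => by
    have := hskew u v w; rw [real_inner_comm _ v] at this; linarith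
  have e1 := a u v w
  have e2 : inner ℝ (T u w) v = - inner ℝ (T w v) u := by rw [hsym u w, a w u v]
  have e3 : inner ℝ (T w v) u = - inner ℝ (T v u) w := by rw [hsym w v, a v w u]
  rw [hsym v u] at e3
  simp
  linarith

end FlatKilling

/-! ### Functions with constant Hessian. -/

section Quadratic

variable {E : Type*} [NormedAddCommGroup E] [InnerProductSpace ℝ E] [CompleteSpace E]

theorem exists_eqOn_const_of_fderiv_eq_zero {E F : Type*} [NormedAddCommGroup E] [NormedSpace ℝ E]
    [NormedAddCommGroup F] [NormedSpace ℝ F] {U : Set E} (hU : IsOpen U)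
    (hc : IsPreconnected U) {f : E → F} (hf : DifferentiableOn ℝ f U)
    (h0 : ∀ x ∈ U, fderiv ℝ f x = 0) : ∃ c, ∀ x ∈ U, f x = c := by
  rcases U.eq_empty_or_nonempty with rfl | ⟨x₀, hx₀⟩
  · exact ⟨0, by simp⟩
  · exact ⟨f x₀, fun x hx => hU.is_const_of_fderiv_eq_zero hc hf (fun y hy => h0 y hy) hx hx₀⟩

theorem hasGradientAt_quadratic {H : E →L[ℝ] E} (hH : ∀ v w, inner ℝ (H v) w = inner ℝ v (H w))
    (b : E) (c : ℝ) (z : E) :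
    HasGradientAt (fun z => 1 / 2 * inner ℝ (H z) z + inner ℝ b z + c) (H z + b) z := by
  rw [hasGradientAt_iff_hasFDerivAt]
  have h1 : HasFDerivAt (fun z => H z) H z := H.hasFDerivAt
  have h2 := (((h1.inner ℝ (hasFDerivAt_id z)).const_mul (1 / 2 : ℝ)).add
    ((hasFDerivAt_const b z).inner ℝ (hasFDerivAt_id z))).add_const c
  refine h2.congr_fderiv ?_
  ext v
  simp [hH v z, real_inner_comm]
  rw [real_inner_comm]; ring

/-- A function with constant Hessian on a connected open set is a polynomial of degree two. -/
theorem exists_quadratic_of_fderiv_gradient_eq {U : Set E} (hU : IsOpen U)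
    (hc : IsPreconnected U) {q : E → ℝ} (hq : ContDiffOn ℝ ∞ q U) {H : E →L[ℝ] E}
    (hH : ∀ v w, inner ℝ (H v) w = inner ℝ v (H w)) (h : ∀ z ∈ U, fderiv ℝ (∇ q) z = H) :
    ∃ (b : E) (c : ℝ), ∀ z ∈ U, q z = 1 / 2 * inner ℝ (H z) z + inner ℝ b z + c := by
  have hq' : ∀ z ∈ U, ContDiffAt ℝ ∞ q z := fun z hz => hq.contDiffAt (hU.mem_nhds hz)
  have hg : ∀ z ∈ U, DifferentiableAt ℝ (∇ q) z := fun z hz =>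
    (hq' z hz).gradient_top.differentiableAt (by simp)
  -- Two integrations: ∇q - H is a constant b, and then q minus the resulting quadratic polynomial
  -- is a constant c.
  obtain ⟨b, hb⟩ := exists_eqOn_const_of_fderiv_eq_zero hU hc (f := fun z => ∇ q z - H z)
    (fun z hz => ((hg z hz).sub H.differentiableAt).differentiableWithinAt) (fun z hz => by
      rw [fderiv_fun_sub (hg z hz) H.differentiableAt, h z hz]; simp)
  have key : ∀ z ∈ U, HasFDerivAt (fun z => q z - (1 / 2 * inner ℝ (H z) z + inner ℝ b z + 0))
      (0 : E →L[ℝ] ℝ) z := by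
    intro z hz
    have h1 := ((hq' z hz).differentiableAt (by simp)).hasGradientAt.hasFDerivAt
    have h2 := (hasGradientAt_quadratic hH b 0 z).hasFDerivAt
    refine (h1.sub h2).congr_fderiv ?_
    rw [← map_sub, ← hb z hz]; simp
  obtain ⟨c, hc'⟩ := exists_eqOn_const_of_fderiv_eq_zero hU hc
    (fun z hz => (key z hz).differentiableAt.differentiableWithinAt)
    (fun z hz => (key z hz).fderiv)
  refine ⟨b, c, fun z hz => ?_⟩
  have := hc' z hz
  linarith

theorem inner_fderiv_gradient {f : E → ℝ} {z : E} (hf : ContDiffAt ℝ ∞ f z) (v w : E) :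
    inner ℝ (fderiv ℝ (∇ f) z v) w = fderiv ℝ (fderiv ℝ f) z v w := by
  have hg : DifferentiableAt ℝ (∇ f) z := hf.gradient_top.differentiableAt (by simp)
  have hd : DifferentiableAt ℝ (fderiv ℝ f) z :=
    (hf.fderiv_right (m := ∞) (by simp)).differentiableAt (by simp)
  have h1 := (hg.hasFDerivAt).inner ℝ (hasFDerivAt_const w z)
  have h2 : HasFDerivAt (fun y => fderiv ℝ f y w) ((fderiv ℝ (fderiv ℝ f) z).flip w) z := by
    simpa using hd.hasFDerivAt.clm_apply (hasFDerivAt_const w z)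
  have h3 : (fun y => inner ℝ (∇ f y) w) = fun y => fderiv ℝ f y w := by
    ext y; exact inner_gradient_left
  rw [h3] at h1
  simpa using congrArg (fun L => L v) (h1.unique h2)

/-- The Hessian of a smooth function is symmetric. -/
theorem inner_fderiv_gradient_symm {f : E → ℝ} {z : E} (hf : ContDiffAt ℝ ∞ f z) (v w : E) :
    inner ℝ (fderiv ℝ (∇ f) z v) w = inner ℝ v (fderiv ℝ (∇ f) z w) := by
  rw [real_inner_comm, real_inner_comm (fderiv ℝ (∇ f) z w), real_inner_comm,
    inner_fderiv_gradient hf, inner_fderiv_gradient hf]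
  exact (hf.isSymmSndFDerivAt (by simpa using two_le_infty)).eq v w

end Quadratic

theorem laplacian_eq_sum_inner_fderiv_gradient {E : Type*} [NormedAddCommGroup E]
    [InnerProductSpace ℝ E] [FiniteDimensional ℝ E] {ι : Type*} [Fintype ι]
    (b : OrthonormalBasis ι ℝ E) {f : E → ℝ} {z : E} (hf : ContDiffAt ℝ ∞ f z) :
    Δ f z = ∑ i, inner ℝ (fderiv ℝ (∇ f) z (b i)) (b i) := by
  rw [InnerProductSpace.laplacian_eq_iteratedFDeriv_orthonormalBasis f b]
  simp [iteratedFDeriv_two_apply, inner_fderiv_gradient hf]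

/-! ### Hermitian operators and Hermitian quadratic polynomials on ℂⁿ. -/

section ComplexSpace

variable {n : ℕ}

theorem complexSpace_inner_eq_re (z w : Cn n) : inner ℝ z w = (inner ℂ z w : ℂ).re := by
  simp [PiLp.inner_apply, Complex.inner]

theorem inner_I_smul_left (z w : Cn n) :
    inner ℝ (Complex.I • z) w = - inner ℝ z (Complex.I • w) := by
  rw [complexSpace_inner_eq_re, complexSpace_inner_eq_re, inner_smul_left, inner_smul_right]
  simp

/-- A unitary transformation as a real linear isometry. -/
noncomputable def unitaryReal (W : Cn n ≃ₗᵢ[ℂ] Cn n) : Cn n ≃ₗᵢ[ℝ] Cn n :=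
  { W.toLinearEquiv.restrictScalars ℝ with norm_map' := W.norm_map }

@[simp] theorem unitaryReal_apply (W : Cn n ≃ₗᵢ[ℂ] Cn n) (z : Cn n) : unitaryReal W z = W z := rfl

@[simp] theorem unitaryReal_symm_apply (W : Cn n ≃ₗᵢ[ℂ] Cn n) (z : Cn n) :
    (unitaryReal W).symm z = W.symm z := rfl

/-- The diagonal operator with entries `α`. -/
noncomputable def diagOp (α : Fin n → ℝ) : Cn n →L[ℂ] Cn n :=
  LinearMap.toContinuousLinearMap
    { toFun := fun z => WithLp.toLp 2 fun k => (α k : ℂ) * z k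
      map_add' := fun x y => by ext k; simp [mul_add]
      map_smul' := fun c x => by ext k; simp; ring }

@[simp] theorem diagOp_apply (α : Fin n → ℝ) (z : Cn n) (k : Fin n) :
    diagOp α z k = (α k : ℂ) * z k := rfl

/-- The Hermitian operator `W⁻¹ diag(α) W`. -/
noncomputable def hermOp (W : Cn n ≃ₗᵢ[ℂ] Cn n) (α : Fin n → ℝ) : Cn n →L[ℝ] Cn n :=
  ((W.symm.toContinuousLinearEquiv : Cn n →L[ℂ] Cn n) ∘L diagOp α ∘L
    (W.toContinuousLinearEquiv : Cn n →L[ℂ] Cn n)).restrictScalars ℝ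

theorem hermOp_apply (W : Cn n ≃ₗᵢ[ℂ] Cn n) (α : Fin n → ℝ) (z : Cn n) :
    hermOp W α z = W.symm (diagOp α (W z)) := rfl

theorem hermOp_I_smul (W : Cn n ≃ₗᵢ[ℂ] Cn n) (α : Fin n → ℝ) (z : Cn n) :
    hermOp W α (Complex.I • z) = Complex.I • hermOp W α z := by
  simp [hermOp_apply]

theorem unitary_inner_symm (W : Cn n ≃ₗᵢ[ℂ] Cn n) (v w : Cn n) :
    inner ℝ (W.symm v) w = inner ℝ v (W w) := by
  rw [← (unitaryReal W).inner_map_map]; simp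

theorem diagOp_inner (α : Fin n → ℝ) (v w : Cn n) :
    inner ℝ (diagOp α v) w = inner ℝ v (diagOp α w) := by
  simp only [PiLp.inner_apply, Complex.inner, diagOp_apply]
  refine Finset.sum_congr rfl fun k _ => ?_
  simp; ring

theorem hermOp_symm (W : Cn n ≃ₗᵢ[ℂ] Cn n) (α : Fin n → ℝ) (v w : Cn n) :
    inner ℝ (hermOp W α v) w = inner ℝ v (hermOp W α w) := by
  rw [hermOp_apply, hermOp_apply, unitary_inner_symm, real_inner_comm _ v, unitary_inner_symm,
    diagOp_inner, real_inner_comm]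

theorem quad_eq_inner (W : Cn n ≃ₗᵢ[ℂ] Cn n) (α : Fin n → ℝ) (z : Cn n) :
    quad α (W z) = 1 / 2 * inner ℝ (hermOp W α z) z := by
  rw [hermOp_apply, unitary_inner_symm]
  simp only [PiLp.inner_apply, Complex.inner, diagOp_apply, quad, Finset.mul_sum]
  refine Finset.sum_congr rfl fun k _ => ?_
  rw [← Complex.normSq_eq_norm_sq, Complex.normSq_apply]
  simp; ring

/-- A polynomial of degree two with complex linear Hessian, in unitary coordinates. -/
noncomputable def hermPoly (W : Cn n ≃ₗᵢ[ℂ] Cn n) (α : Fin n → ℝ) (b : Cn n) (c : ℝ) (z : Cn n) : ℝ :=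
  quad α (W z) + inner ℝ b z + c

theorem hasGradientAt_hermPoly (W : Cn n ≃ₗᵢ[ℂ] Cn n) (α : Fin n → ℝ) (b : Cn n) (c : ℝ)
    (z : Cn n) : HasGradientAt (hermPoly W α b c) (hermOp W α z + b) z := by
  have := hasGradientAt_quadratic (hermOp_symm W α) b c z
  unfold hermPoly
  simpa only [quad_eq_inner] using this

theorem gradient_hermPoly (W : Cn n ≃ₗᵢ[ℂ] Cn n) (α : Fin n → ℝ) (b : Cn n) (c : ℝ) :
    ∇ (hermPoly W α b c) = fun z => hermOp W α z + b :=
  funext fun z => (hasGradientAt_hermPoly W α b c z).gradient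

theorem contDiff_hermPoly (W : Cn n ≃ₗᵢ[ℂ] Cn n) (α : Fin n → ℝ) (b : Cn n) (c : ℝ) :
    ContDiff ℝ ∞ (hermPoly W α b c) := by
  unfold hermPoly
  simp only [quad_eq_inner]
  have := (hermOp W α).contDiff (n := ∞)
  exact ((contDiff_const.mul (this.inner ℝ contDiff_id)).add
    (contDiff_const.inner ℝ contDiff_id)).add contDiff_const

theorem fderiv_gradient_hermPoly (W : Cn n ≃ₗᵢ[ℂ] Cn n) (α : Fin n → ℝ) (b : Cn n) (c : ℝ)
    (z : Cn n) : fderiv ℝ (∇ (hermPoly W α b c)) z = hermOp W α := by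
  rw [gradient_hermPoly]
  simp

/-- In the real basis W⁻¹e_k, W⁻¹(i e_k) the Hessian is diagonal, and each α_k occurs twice. -/
theorem laplacian_hermPoly (W : Cn n ≃ₗᵢ[ℂ] Cn n) (α : Fin n → ℝ) (b : Cn n) (c : ℝ)
    (z : Cn n) : Δ (hermPoly W α b c) z = 2 * ∑ k, α k := by
  rw [laplacian_eq_sum_inner_fderiv_gradient
    ((Pi.orthonormalBasis (fun _ : Fin n => Complex.orthonormalBasisOneI)).map
      (unitaryReal W).symm) (contDiff_hermPoly W α b c).contDiffAt]
  simp only [fderiv_gradient_hermPoly, OrthonormalBasis.map_apply, unitaryReal_symm_apply,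
    hermOp_apply, LinearIsometryEquiv.apply_symm_apply, unitary_inner_symm,
    Fintype.sum_sigma, Pi.orthonormalBasis_apply, Finset.mul_sum]
  refine Finset.sum_congr rfl fun k _ => ?_
  simp only [PiLp.inner_apply, diagOp_apply, Fin.sum_univ_two]
  rw [Finset.sum_eq_single k, Finset.sum_eq_single k]
  · simp [Complex.inner]; ring
  all_goals simp +contextual

theorem norm_gradient_hermPoly (W : Cn n ≃ₗᵢ[ℂ] Cn n) (α : Fin n → ℝ) (b : Cn n) (c : ℝ)
    (z : Cn n) : ‖∇ (hermPoly W α b c) z‖ ^ 2 = ‖diagOp α (W z) + W b‖ ^ 2 := by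
  rw [gradient_hermPoly, ← W.norm_map]
  simp [hermOp_apply]

end ComplexSpace

/-! ### The substitution turning γ into q. -/

section Potential

variable {n : ℕ}

theorem ContDiffAt.potential {q : Cn n → ℝ} {z : Cn n} (hq : ContDiffAt ℝ ∞ q z)
    (hpos : n ≠ 3 → 0 < q z) : ContDiffAt ℝ ∞ (potential n q) z := by
  by_cases h : n = 3
  · have : BiharmonicExample.potential n q = q := by ext; simp [BiharmonicExample.potential, h]
    rwa [this]
  · have : BiharmonicExample.potential n q = fun z => 1 / ((n : ℝ) - 3) * Real.log (q z) := by
      ext; simp [BiharmonicExample.potential, h]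
    rw [this]
    exact contDiffAt_const.mul (hq.log (hpos h).ne')

theorem gradient_potential_of_ne {q : Cn n → ℝ} {z : Cn n} (hq : DifferentiableAt ℝ q z)
    (h : n ≠ 3) (hpos : 0 < q z) :
    ∇ (potential n q) z = (1 / ((n : ℝ) - 3) / q z) • ∇ q z := by
  have h1 : HasFDerivAt q (InnerProductSpace.toDual ℝ (Cn n) (∇ q z)) z :=
    hq.hasGradientAt.hasFDerivAt
  have h2 := (h1.log hpos.ne').const_mul (1 / ((n : ℝ) - 3))
  have h3 : potential n q = fun z => 1 / ((n : ℝ) - 3) * Real.log (q z) := by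
    ext; simp [potential, h]
  refine HasGradientAt.gradient (hasGradientAt_iff_hasFDerivAt.2 ?_)
  rw [h3]
  refine h2.congr_fderiv ?_
  ext v
  simp
  ring

/-- The factor `1 / (n - 3)` if `n ≠ 3`, and `1` otherwise. -/
noncomputable def potentialFactor (n : ℕ) : ℝ := if n = 3 then 1 else 1 / ((n : ℝ) - 3)

theorem sub_three_ne_zero (h : n ≠ 3) : (n : ℝ) - 3 ≠ 0 := by
  rw [sub_ne_zero]; exact_mod_cast h

theorem potentialFactor_ne_zero (n : ℕ) : potentialFactor n ≠ 0 := by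
  unfold potentialFactor
  split_ifs with h
  · simp
  · exact one_div_ne_zero (sub_three_ne_zero h)

/-- The exponential factor equals q and cancels the 1/q of grad ln q, so the field becomes linear in
q. -/
theorem twistedGrad_potential {q : Cn n → ℝ} {z : Cn n} (hq : ContDiffAt ℝ ∞ q z)
    (hpos : n ≠ 3 → 0 < q z) :
    twistedGrad (potential n q) z = Complex.I • (potentialFactor n • ∇ q z) := by
  unfold twistedGrad
  congr 1
  by_cases h : n = 3
  · have : potential n q = q := by ext; simp [potential, h]
    rw [this]; simp [h, potentialFactor]
  · rw [gradient_potential_of_ne (hq.differentiableAt (by simp)) h (hpos h), smul_smul]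
    congr 1
    have h0 := sub_three_ne_zero h
    have : ((n : ℝ) - 3) * potential n q z = Real.log (q z) := by
      simp only [potential, h, if_false]; field_simp
    rw [this, Real.exp_log (hpos h), potentialFactor, if_neg h]
    have := (hpos h).ne'
    field_simp

theorem twistedGrad_congr {γ γ' : Cn n → ℝ} {z : Cn n} (h : γ =ᶠ[nhds z] γ') :
    twistedGrad γ z = twistedGrad γ' z := by
  simp only [twistedGrad, h.eq_of_nhds, h.gradient_eq]

theorem SolvesOn.congr {U : Set (Cn n)} (hU : IsOpen U) {γ γ' : Cn n → ℝ}
    (h : ∀ z ∈ U, γ z = γ' z) : SolvesOn U γ ↔ SolvesOn U γ' := by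
  refine forall₂_congr fun z hz => ?_
  have h' : γ =ᶠ[nhds z] γ' := Filter.eventuallyEq_of_mem (hU.mem_nhds hz) h
  rw [h'.gradient_eq, (InnerProductSpace.laplacian_congr_nhds h').eq_of_nhds]

theorem laplacian_potential_of_ne {q : Cn n → ℝ} {z : Cn n} (hq : ContDiffAt ℝ ∞ q z)
    (h : n ≠ 3) (hpos : 0 < q z) :
    Δ (potential n q) z =
      1 / ((n : ℝ) - 3) * (Δ q z / q z - ‖∇ q z‖ ^ 2 / q z ^ 2) := by
  have hb := stdOrthonormalBasis ℝ (Cn n)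
  have hev : ∇ (potential n q) =ᶠ[nhds z] fun y => (1 / ((n : ℝ) - 3) / q y) • ∇ q y := by
    filter_upwards [(hq.of_le (m := 1) (by simp)).eventually (by simp),
      hq.continuousAt.eventually (lt_mem_nhds hpos)] with y h1 h2
    exact gradient_potential_of_ne (h1.differentiableAt (by simp)) h h2
  rw [laplacian_eq_sum_inner_fderiv_gradient hb (hq.potential fun _ => hpos),
    laplacian_eq_sum_inner_fderiv_gradient hb hq, hev.fderiv_eq]
  have h1 : HasFDerivAt q (InnerProductSpace.toDual ℝ (Cn n) (∇ q z)) z :=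
    ((hq.differentiableAt (by simp)).hasGradientAt).hasFDerivAt
  have h2 : HasFDerivAt (∇ q) (fderiv ℝ (∇ q) z) z :=
    (hq.gradient_top.differentiableAt (by simp)).hasFDerivAt
  have h3 : HasFDerivAt (fun y => 1 / ((n : ℝ) - 3) / q y)
      ((-(1 / ((n : ℝ) - 3) / q z ^ 2)) • InnerProductSpace.toDual ℝ (Cn n) (∇ q z)) z := by
    have := ((hasDerivAt_inv hpos.ne').comp_hasFDerivAt z h1).const_mul (1 / ((n : ℝ) - 3))
    have hfun : (fun y => 1 / ((n : ℝ) - 3) / q y) =ᶠ[nhds z]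
        fun y => 1 / ((n : ℝ) - 3) * (Inv.inv ∘ q) y := .of_eq (funext fun y => by
      simp [div_eq_mul_inv])
    refine (this.congr_of_eventuallyEq hfun).congr_fderiv ?_
    ext v; simp; ring
  have h4 := (h3.fun_smul h2).fderiv
  rw [h4, ← hb.sum_sq_norm_inner_right]
  simp only [Finset.sum_div, ← Finset.sum_sub_distrib, Finset.mul_sum]
  refine Finset.sum_congr rfl fun i _ => ?_
  simp [inner_add_left, inner_smul_left, real_inner_comm]
  ring

/-- For n ≠ 3, multiply by (n-3)²q²: the coefficient of |grad q|² is -(n-3) from the Laplacian of ln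
q plus n-1 from the gradient term, that is 2. -/
theorem solves_potential_iff {q : Cn n → ℝ} {z : Cn n} (hq : ContDiffAt ℝ ∞ q z)
    (hpos : n ≠ 3 → 0 < q z) :
    Δ (potential n q) z + ((2 * (n : ℝ) - 2) / 2) * ‖∇ (potential n q) z‖ ^ 2 = 0 ↔
      (if n = 3 then 1 else ((n : ℝ) - 3) * q z) * Δ q z + 2 * ‖∇ q z‖ ^ 2 = 0 := by
  by_cases h : n = 3
  · subst h
    have : potential 3 q = q := by ext; simp [potential]
    rw [this]; norm_num
  · have h0 := sub_three_ne_zero h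
    have h1 := (hpos h).ne'
    rw [laplacian_potential_of_ne hq h (hpos h), gradient_potential_of_ne (hq.differentiableAt (by simp)) h (hpos h), norm_smul,
      mul_pow, if_neg h, Real.norm_eq_abs, sq_abs]
    have : 1 / ((n : ℝ) - 3) * (Δ q z / q z - ‖∇ q z‖ ^ 2 / q z ^ 2) + (2 * (n : ℝ) - 2) / 2 *
        ((1 / ((n : ℝ) - 3) / q z) ^ 2 * ‖∇ q z‖ ^ 2) =
        (((n : ℝ) - 3) * q z * Δ q z + 2 * ‖∇ q z‖ ^ 2) / (((n : ℝ) - 3) ^ 2 * q z ^ 2) := by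
      field_simp; ring
    rw [this, div_eq_zero_iff]
    simp [h0, h1]

end Potential

/-! ### Classification of the Killing case. -/

section KillingClassification

variable {n : ℕ} {U : Set (Cn n)}

/-- The field is affine with linear part a multiple of iH, which is skew because H is symmetric and
commutes with i. -/
theorem isKillingOn_of_eqOn_potential_hermPoly (hU : IsOpen U) {γ : Cn n → ℝ}
    {W : Cn n ≃ₗᵢ[ℂ] Cn n} {α : Fin n → ℝ} {b : Cn n} {c : ℝ}
    (hpos : n ≠ 3 → ∀ z ∈ U, 0 < hermPoly W α b c z)
    (h : ∀ z ∈ U, γ z = potential n (hermPoly W α b c) z) :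
    IsKillingOn (flatMetric (Cn n)) U (twistedGrad γ) := by
  have hX : ∀ z ∈ U, twistedGrad γ z =
      Complex.I • (potentialFactor n • (hermOp W α z + b)) := fun z hz => by
    rw [twistedGrad_congr (Filter.eventuallyEq_of_mem (hU.mem_nhds hz) h),
      twistedGrad_potential (contDiff_hermPoly W α b c).contDiffAt (fun h3 => hpos h3 z hz),
      gradient_hermPoly]
  rw [isKillingOn_flatMetric_iff]
  refine ⟨ContDiffOn.congr (ContDiff.contDiffOn ?_) hX, fun z hz v w => ?_⟩
  · exact (((hermOp W α).contDiff.add contDiff_const).const_smul _).const_smul _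
  · have h1 : HasFDerivAt (fun z => Complex.I • (potentialFactor n • (hermOp W α z + b)))
        (Complex.I • (potentialFactor n • hermOp W α)) z :=
      (((hermOp W α).hasFDerivAt.add_const b).fun_const_smul _).fun_const_smul _
    rw [(h1.congr_of_eventuallyEq (Filter.eventuallyEq_of_mem (hU.mem_nhds hz) hX)).fderiv]
    simp only [smul_apply, smul_comm Complex.I, inner_smul_left,
      inner_smul_right, inner_I_smul_left]
    rw [← hermOp_I_smul, ← hermOp_symm, real_inner_comm]
    simp

/-- The real scalar product is the real part of the Hermitian one; testing against i w recovers the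
imaginary part. -/
theorem isSymmetric_of_real {H : Cn n →ₗ[ℂ] Cn n}
    (hH : ∀ v w, inner ℝ (H v) w = inner ℝ v (H w)) : H.IsSymmetric := by
  intro v w
  have hre : ∀ v w, (inner ℂ (H v) w : ℂ).re = (inner ℂ v (H w) : ℂ).re := fun v w => by
    rw [← complexSpace_inner_eq_re, ← complexSpace_inner_eq_re, hH]
  refine Complex.ext (hre v w) ?_
  have := hre v (Complex.I • w)
  rw [map_smul, inner_smul_right, inner_smul_right] at this
  simpa using this

/-- A complex linear operator which is symmetric for the real scalar product is unitarily
diagonalizable with real eigenvalues. -/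
theorem exists_eq_hermOp {H : Cn n →L[ℝ] Cn n} (hI : ∀ v, H (Complex.I • v) = Complex.I • H v)
    (hH : ∀ v w, inner ℝ (H v) w = inner ℝ v (H w)) :
    ∃ (W : Cn n ≃ₗᵢ[ℂ] Cn n) (α : Fin n → ℝ), H = hermOp W α := by
  -- Commuting with i upgrades real linearity to complex linearity, which opens the way to the
  -- spectral theorem over ℂ.
  let T : Cn n →ₗ[ℂ] Cn n :=
    { toFun := H
      map_add' := map_add H
      map_smul' := fun c x => by
        have : ∀ y : Cn n, c • y = c.re • y + c.im • (Complex.I • y) := fun y => by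
          conv_lhs => rw [← Complex.re_add_im c]
          rw [add_smul, mul_smul]; simp
        rw [this, map_add, map_smul, map_smul, hI, RingHom.id_apply, this] }
  have hT : T.IsSymmetric := isSymmetric_of_real (H := T) hH
  have hn : Module.finrank ℂ (Cn n) = n := by simp
  refine ⟨(hT.eigenvectorBasis hn).repr, hT.eigenvalues hn, ?_⟩
  ext1 z
  rw [hermOp_apply, LinearIsometryEquiv.eq_symm_apply]
  ext k
  exact hT.eigenvectorBasis_apply_self_apply hn z k

/-- The function `q` with `γ = potential n q`. -/
noncomputable def depotential (γ : Cn n → ℝ) (z : Cn n) : ℝ :=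
  if n = 3 then γ z else Real.exp (((n : ℝ) - 3) * γ z)

theorem potential_depotential (γ : Cn n → ℝ) : potential n (depotential γ) = γ := by
  ext z
  by_cases h : n = 3
  · simp [potential, depotential, h]
  · have := sub_three_ne_zero h
    simp [potential, depotential, h, this]

theorem depotential_pos (γ : Cn n → ℝ) (h : n ≠ 3) (z : Cn n) : 0 < depotential γ z := by
  simp [depotential, h, Real.exp_pos]

theorem ContDiffOn.depotential {γ : Cn n → ℝ} (hγ : ContDiffOn ℝ ∞ γ U) :
    ContDiffOn ℝ ∞ (depotential γ) U := by
  unfold _root_.depotential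
  by_cases h : n = 3
  · simpa [h] using hγ
  · simpa [h] using (contDiffOn_const.mul hγ).exp

/-- The derivative of the Killing field is constant, and it is i times a nonzero multiple of the
Hessian of q. Hence that Hessian is constant, and the Killing equation at one point suffices to see
that it commutes with i. -/
theorem exists_depotential_eq_hermPoly (hU : IsOpen U) (hc : IsConnected U) {γ : Cn n → ℝ}
    (hγ : ContDiffOn ℝ ∞ γ U) (hK : IsKillingOn (flatMetric (Cn n)) U (twistedGrad γ)) :
    ∃ (W : Cn n ≃ₗᵢ[ℂ] Cn n) (α : Fin n → ℝ) (b : Cn n) (c : ℝ),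
      ∀ z ∈ U, depotential γ z = hermPoly W α b c z := by
  set q := depotential γ with hq_def
  have hqs : ContDiffOn ℝ ∞ q U := hγ.depotential
  have hq : ∀ z ∈ U, ContDiffAt ℝ ∞ q z := fun z hz => hqs.contDiffAt (hU.mem_nhds hz)
  have hX : ∀ z ∈ U, twistedGrad γ z = Complex.I • (potentialFactor n • ∇ q z) := fun z hz => by
    rw [← twistedGrad_potential (hq z hz) fun h => depotential_pos γ h z, potential_depotential]
  have hX' : ∀ z ∈ U, fderiv ℝ (twistedGrad γ) z =
      Complex.I • (potentialFactor n • fderiv ℝ (∇ q) z) := fun z hz => by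
    have h1 := ((hq z hz).gradient_top.differentiableAt (by simp)).hasFDerivAt
    exact (((h1.fun_const_smul _).fun_const_smul _).congr_of_eventuallyEq
      (Filter.eventuallyEq_of_mem (hU.mem_nhds hz) hX)).fderiv
  obtain ⟨z₀, hz₀⟩ := hc.nonempty
  obtain ⟨A, hA⟩ := exists_eqOn_const_of_fderiv_eq_zero hU hc.isPreconnected
    (f := fderiv ℝ (twistedGrad γ))
    (fun z hz => (((hK.1.contDiffAt (hU.mem_nhds hz)).fderiv_right (m := ∞)
      (by simp)).differentiableAt (by simp)).differentiableWithinAt)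
    (fun z hz => fderiv_fderiv_eq_zero_of_killing hU hK hz)
  have hκ := potentialFactor_ne_zero n
  have hconst : ∀ z ∈ U, fderiv ℝ (∇ q) z = fderiv ℝ (∇ q) z₀ := fun z hz => by
    have h1 := (hX' z hz).symm.trans ((hA z hz).trans ((hA z₀ hz₀).symm.trans (hX' z₀ hz₀)))
    exact smul_right_injective _ hκ (smul_right_injective _ Complex.I_ne_zero h1)
  have hsymm := inner_fderiv_gradient_symm (hq z₀ hz₀)
  set H := fderiv ℝ (∇ q) z₀
  have hI : ∀ v, H (Complex.I • v) = Complex.I • H v := fun v => by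
    refine ext_inner_right ℝ fun w => ?_
    have h1 := ((isKillingOn_flatMetric_iff.1 hK).2 z₀ hz₀) v w
    rw [hX' z₀ hz₀] at h1
    simp only [smul_apply, smul_comm Complex.I, inner_smul_left,
      inner_smul_right, conj_trivial, ← mul_add] at h1
    have h2 : inner ℝ (Complex.I • H v) w + inner ℝ v (Complex.I • H w) = 0 :=
      (mul_eq_zero.1 h1).resolve_left hκ
    have h3 := inner_I_smul_left v (H w)
    rw [hsymm]
    linarith
  obtain ⟨W, α, hWα⟩ := exists_eq_hermOp hI hsymm
  obtain ⟨b, c, hbc⟩ := exists_quadratic_of_fderiv_gradient_eq hU hc.isPreconnected hqs hsymm hconst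
  refine ⟨W, α, b, c, fun z hz => ?_⟩
  rw [hbc z hz, hermPoly, quad_eq_inner, hWα]

theorem potential_congr {q q' : Cn n → ℝ} {z : Cn n} (h : q z = q' z) :
    potential n q z = potential n q' z := by
  simp [potential, h]

theorem isKillingOn_twistedGrad_iff (hU : IsOpen U) (hc : IsConnected U) {γ : Cn n → ℝ}
    (hγ : ContDiffOn ℝ ∞ γ U) :
    IsKillingOn (flatMetric (Cn n)) U (twistedGrad γ) ↔
      ∃ (W : Cn n ≃ₗᵢ[ℂ] Cn n) (α : Fin n → ℝ) (b : Cn n) (c : ℝ),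
        (n ≠ 3 → ∀ z ∈ U, 0 < hermPoly W α b c z) ∧
        ∀ z ∈ U, γ z = potential n (hermPoly W α b c) z := by
  constructor
  · intro hK
    obtain ⟨W, α, b, c, h⟩ := exists_depotential_eq_hermPoly hU hc hγ hK
    refine ⟨W, α, b, c, fun h3 z hz => h z hz ▸ depotential_pos γ h3 z, fun z hz => ?_⟩
    rw [← potential_congr (h z hz), potential_depotential]
  · rintro ⟨W, α, b, c, hpos, h⟩
    exact isKillingOn_of_eqOn_potential_hermPoly hU hpos h

end KillingClassification

/-! ### Solutions of (*) among Hermitian quadratic polynomials. -/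

section Solutions

variable {n : ℕ} {U : Set (Cn n)}

theorem quad_add_single (m : Fin n → ℝ) (w : Cn n) (k : Fin n) (t : ℝ) :
    quad m (w + t • EuclideanSpace.single k (1 : ℂ)) =
      quad m w + t * (m k * (w k).re) + t ^ 2 * (m k / 2) := by
  have : ∀ j, m j / 2 * ‖(w + t • EuclideanSpace.single k (1 : ℂ)) j‖ ^ 2 =
      m j / 2 * ‖w j‖ ^ 2 + if j = k then t * (m k * (w k).re) + t ^ 2 * (m k / 2) else 0 := by
    intro j
    split_ifs with h
    · subst h
      rw [← Complex.normSq_eq_norm_sq, ← Complex.normSq_eq_norm_sq, Complex.normSq_apply,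
        Complex.normSq_apply]
      simp; ring
    · simp [h]
  simp only [quad, this, Finset.sum_add_distrib]
  simp; ring

/-- A quadratic is determined by its values at 0 and ±ε/2, all within the interval where it
vanishes. -/
theorem coeffs_eq_zero_of_frequently {a b c : ℝ}
    (h : ∀ᶠ t : ℝ in nhds 0, a * t ^ 2 + b * t + c = 0) : a = 0 ∧ b = 0 ∧ c = 0 := by
  obtain ⟨ε, hε, hb⟩ := Metric.eventually_nhds_iff.1 h
  have h0 := hb (y := 0) (by simpa using hε)
  have h1 := hb (y := ε / 2) (by simp [abs_of_pos hε]; linarith)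
  have h2 := hb (y := -(ε / 2)) (by simp [abs_of_pos hε]; linarith)
  have hc : c = 0 := by simpa using h0
  subst hc
  have hbz : b * ε = 0 := by linarith
  have haz : a * ε ^ 2 = 0 := by linarith
  simpa [hε.ne'] using And.intro haz hbz

/-- A polynomial `∑ m_k/2 |w_k|² + ⟨l, w⟩ + d` which vanishes on a nonempty open set is zero. -/
theorem hermitian_poly_eq_zero {V : Set (Cn n)} (hV : IsOpen V) (hne : V.Nonempty)
    {m : Fin n → ℝ} {l : Cn n} {d : ℝ} (h : ∀ w ∈ V, quad m w + inner ℝ l w + d = 0) :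
    m = 0 ∧ l = 0 ∧ d = 0 := by
  obtain ⟨w, hw⟩ := hne
  have hline : ∀ v : Cn n, ∀ᶠ t : ℝ in nhds 0, w + t • v ∈ V := fun v => by
    have : Filter.Tendsto (fun t : ℝ => w + t • v) (nhds 0) (nhds w) := by
      have : Continuous (fun t : ℝ => w + t • v) := by fun_prop
      simpa using this.tendsto 0
    exact this (hV.mem_nhds hw)
  -- On the line through w in the direction e_k, the t² coefficient is m_k/2. Once m = 0, the t
  -- coefficient in an arbitrary direction v is ⟨l, v⟩.
  have hm : m = 0 := by
    ext k
    have := coeffs_eq_zero_of_frequently (a := m k / 2)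
      (b := m k * (w k).re + inner ℝ l (EuclideanSpace.single k (1 : ℂ)))
      (c := quad m w + inner ℝ l w + d) (by
        filter_upwards [hline (EuclideanSpace.single k (1 : ℂ))] with t ht
        have := h _ ht
        rw [quad_add_single, inner_add_right, inner_smul_right] at this
        linarith)
    simpa using this.1
  subst hm
  have hl : l = 0 := by
    refine ext_inner_right ℝ fun v => ?_
    have := coeffs_eq_zero_of_frequently (a := 0) (b := inner ℝ l v)
      (c := inner ℝ l w + d) (by
        filter_upwards [hline v] with t ht
        have := h _ ht
        simp only [quad, inner_add_right, inner_smul_right] at this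
        simp at this
        linarith)
    simpa using this.2.1
  subst hl
  exact ⟨rfl, rfl, by simpa [quad] using h w hw⟩

/-- This brings |grad q|² to the same quadratic, linear and constant form as q, so that coefficients
can be compared. -/
theorem norm_diagOp_add (α : Fin n → ℝ) (b w : Cn n) :
    ‖diagOp α w + b‖ ^ 2 =
      quad (fun k => 2 * α k ^ 2) w + inner ℝ (2 • diagOp α b) w + ‖b‖ ^ 2 := by
  rw [norm_add_sq_real, ← real_inner_self_eq_norm_sq (diagOp α w), diagOp_inner, two_smul,
    inner_add_left, diagOp_inner, diagOp_inner]
  have : inner ℝ w (diagOp α (diagOp α w)) = quad (fun k => 2 * α k ^ 2) w := by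
    simp only [PiLp.inner_apply, Complex.inner, diagOp_apply, quad]
    refine Finset.sum_congr rfl fun k _ => ?_
    rw [← Complex.normSq_eq_norm_sq, Complex.normSq_apply]
    simp; ring
  have e : inner ℝ w (diagOp α b) = inner ℝ b (diagOp α w) := by
    rw [real_inner_comm, diagOp_inner]
  rw [this, e]; ring

/-- The equation for a quadratic potential forces it to be constant, or to have a single
eigenvalue in complex dimension two. -/
theorem solution_coefficients (hn : 2 ≤ n) {V : Set (Cn n)} (hV : IsOpen V) (hne : V.Nonempty)
    {α : Fin n → ℝ} {b : Cn n} {c : ℝ}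
    (h : ∀ w ∈ V, (if n = 3 then 1 else ((n : ℝ) - 3) * (quad α w + inner ℝ b w + c)) *
      (2 * ∑ k, α k) + 2 * ‖diagOp α w + b‖ ^ 2 = 0) :
    (α = 0 ∧ b = 0) ∨
      (n = 2 ∧ ∃ a : ℝ, a ≠ 0 ∧ α = (fun _ => a) ∧ c = ‖b‖ ^ 2 / (2 * a)) := by
  set S := ∑ k, α k with hS
  by_cases h3 : n = 3
  · left
    obtain ⟨hm, -, hd⟩ := hermitian_poly_eq_zero hV hne (m := fun k => 2 * α k ^ 2)
      (l := 2 • diagOp α b) (d := S + ‖b‖ ^ 2) (fun w hw => by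
        have := h w hw
        rw [if_pos h3, norm_diagOp_add] at this
        linarith)
    have hα : α = 0 := by
      ext k
      simpa using congrFun hm k
    refine ⟨hα, ?_⟩
    simpa [hS, hα] using hd
  · have hN := sub_three_ne_zero h3
    set N := (n : ℝ) - 3 with hN_def
    obtain ⟨hm, hl, hd⟩ := hermitian_poly_eq_zero hV hne
      (m := fun k => 2 * N * S * α k + 4 * α k ^ 2)
      (l := (2 * N * S) • b + (4 : ℝ) • diagOp α b)
      (d := 2 * N * S * c + 2 * ‖b‖ ^ 2) (fun w hw => by
        have := h w hw
        rw [if_neg h3, norm_diagOp_add] at this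
        have hq : quad (fun k => 2 * N * S * α k + 4 * α k ^ 2) w =
            2 * N * S * quad α w + 2 * quad (fun k => 2 * α k ^ 2) w := by
          simp only [quad, Finset.mul_sum, ← Finset.sum_add_distrib]
          exact Finset.sum_congr rfl fun k _ => by ring
        rw [hq, inner_add_left, inner_smul_left, inner_smul_left]
        rw [two_smul, inner_add_left] at this
        simp only [conj_trivial]
        linarith)
    have hm' : ∀ k, α k = 0 ∨ α k = -(N * S) / 2 := fun k => by
      have h1 : α k * (2 * N * S + 4 * α k) = 0 := by
        have := congrFun hm k
        simp only [Pi.zero_apply] at this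
        linarith
      rcases mul_eq_zero.1 h1 with h | h
      · exact Or.inl h
      · right; linarith
    by_cases hα : α = 0
    · left
      refine ⟨hα, ?_⟩
      simpa [hS, hα] using hd
    · right
      have hS0 : S ≠ 0 := fun h0 => hα (by
        ext k
        rcases hm' k with h | h
        · exact h
        · simpa [h0] using h)
      classical
      -- All nonzero α_k share the value -NS/2, so summing them counts how many there are.
      have hsum : S = (Finset.univ.filter fun k => α k ≠ 0).card * (-(N * S) / 2) := by
        rw [← nsmul_eq_mul, ← Finset.sum_const, Finset.sum_filter, hS]
        refine Finset.sum_congr rfl fun k _ => ?_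
        split_ifs with hk
        · exact (hm' k).resolve_left hk
        · exact not_not.1 hk
      set L := (Finset.univ.filter fun k => α k ≠ 0).card with hL
      have hLN : (L : ℝ) * (3 - n) = 2 := by
        have : S * ((L : ℝ) * (3 - n) - 2) = 0 := by rw [hN_def] at hsum; linarith
        linarith [(mul_eq_zero.1 this).resolve_left hS0]
      -- If n ≥ 4 the left side of L(3-n) = 2 is nonpositive, and n = 3 is already excluded.
      have hn2 : n = 2 := by
        by_contra hne2
        have : (4 : ℝ) ≤ n := by
          have : 4 ≤ n := by omega
          exact_mod_cast this
        nlinarith [(Nat.cast_nonneg L : (0 : ℝ) ≤ L)]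
      have hL2 : L = n := by
        have : (L : ℝ) = 2 := by rw [hn2] at hLN; norm_num at hLN; exact hLN
        rw [hn2]; exact_mod_cast this
      have hall : ∀ k, α k ≠ 0 := fun k => by
        have hcard : (Finset.univ.filter fun k => α k ≠ 0).card = Fintype.card (Fin n) := by
          rw [← hL, hL2]; simp
        have := Finset.card_eq_iff_eq_univ _ |>.1 hcard
        have hk : k ∈ Finset.univ.filter fun k => α k ≠ 0 := by rw [this]; simp
        simpa using hk
      have hN1 : N = -1 := by rw [hN_def, hn2]; norm_num
      refine ⟨hn2, S / 2, by simpa using hS0, ?_, ?_⟩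
      · ext k
        rw [(hm' k).resolve_left (hall k), hN1]; ring
      -- With N = -1 the constant term reads Sc = ‖b‖², which fixes c.
      · rw [hN1] at hd
        field_simp
        linarith

theorem solvesOn_hermPoly_iff {W : Cn n ≃ₗᵢ[ℂ] Cn n} {α : Fin n → ℝ} {b : Cn n} {c : ℝ}
    (hpos : n ≠ 3 → ∀ z ∈ U, 0 < hermPoly W α b c z) :
    SolvesOn U (potential n (hermPoly W α b c)) ↔
      ∀ z ∈ U, (if n = 3 then 1 else ((n : ℝ) - 3) * hermPoly W α b c z) *
        (2 * ∑ k, α k) + 2 * ‖diagOp α (W z) + W b‖ ^ 2 = 0 := by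
  refine forall₂_congr fun z hz => ?_
  rw [solves_potential_iff (contDiff_hermPoly W α b c).contDiffAt fun h => hpos h z hz,
    laplacian_hermPoly, norm_gradient_hermPoly]

/-- In the coordinate w = Wz the polynomial is diagonal with linear part Wb, the form to which
`solution_coefficients` applies. -/
theorem hermPoly_eq_symm (W : Cn n ≃ₗᵢ[ℂ] Cn n) (α : Fin n → ℝ) (b : Cn n) (c : ℝ) (w : Cn n) :
    hermPoly W α b c (W.symm w) = quad α w + inner ℝ (W b) w + c := by
  rw [hermPoly, W.apply_symm_apply, real_inner_comm, unitary_inner_symm, real_inner_comm]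

theorem solvesOn_hermPoly_cases (hn : 2 ≤ n) (hU : IsOpen U) (hne : U.Nonempty)
    {W : Cn n ≃ₗᵢ[ℂ] Cn n} {α : Fin n → ℝ} {b : Cn n} {c : ℝ}
    (hpos : n ≠ 3 → ∀ z ∈ U, 0 < hermPoly W α b c z)
    (h : SolvesOn U (potential n (hermPoly W α b c))) :
    (α = 0 ∧ b = 0) ∨
      (n = 2 ∧ ∃ a : ℝ, a ≠ 0 ∧ α = (fun _ => a) ∧ c = ‖b‖ ^ 2 / (2 * a)) := by
  rw [solvesOn_hermPoly_iff hpos] at h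
  have := solution_coefficients hn (V := W.symm ⁻¹' U) (hU.preimage W.symm.continuous)
    (hne.preimage W.symm.surjective) (α := α) (b := W b) (c := c) (fun w hw => by
      have := h _ hw
      rwa [hermPoly_eq_symm, W.apply_symm_apply] at this)
  simpa using this

theorem quad_const (a : ℝ) (z : Cn n) : quad (fun _ => a) z = a / 2 * ‖z‖ ^ 2 := by
  rw [quad, EuclideanSpace.norm_sq_eq, Finset.mul_sum]

/-- Completing the square: this value of c is exactly the one that leaves no remainder, with centre
-b/a. -/
theorem hermPoly_const_eq (W : Cn n ≃ₗᵢ[ℂ] Cn n) {a : ℝ} (ha : a ≠ 0) (b z : Cn n) :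
    hermPoly W (fun _ => a) b (‖b‖ ^ 2 / (2 * a)) z = quad (fun _ => a) (z - (-(1 / a)) • b) := by
  rw [hermPoly, quad_const, quad_const, W.norm_map, norm_sub_sq_real, inner_smul_right, norm_smul,
    mul_pow, Real.norm_eq_abs, sq_abs, real_inner_comm]
  field_simp
  ring

theorem solvesOn_of_const (hn : n = 2) {W : Cn n ≃ₗᵢ[ℂ] Cn n} {a : ℝ} (ha : a ≠ 0) {b : Cn n}
    (hpos : ∀ z ∈ U, 0 < hermPoly W (fun _ => a) b (‖b‖ ^ 2 / (2 * a)) z) :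
    SolvesOn U (potential n (hermPoly W (fun _ => a) b (‖b‖ ^ 2 / (2 * a)))) := by
  rw [solvesOn_hermPoly_iff fun _ => hpos]
  intro z _
  have h3 : n ≠ 3 := by omega
  have h1 : diagOp (fun _ => a) (W z) + W b = a • W (z - (-(1 / a)) • b) := by
    have : diagOp (fun _ => a) (W z) = a • W z := by ext k; simp
    rw [this, map_sub, smul_sub, ← unitaryReal_apply W ((-(1 / a)) • b), map_smul, smul_smul]
    simp [ha]
  rw [if_neg h3, h1, norm_smul, W.norm_map, hermPoly_const_eq W ha, quad_const]
  subst hn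
  rw [mul_pow, Real.norm_eq_abs, sq_abs]
  simp
  ring

end Solutions

/-! ### The statements about radial and nonconstant solutions. -/

section MainFlat

variable {n : ℕ} {U : Set (Cn n)}

theorem quad_eq_hermPoly (α : Fin n → ℝ) :
    quad α = hermPoly (LinearIsometryEquiv.refl ℂ (Cn n)) α 0 0 := by
  ext z; simp [hermPoly]

theorem isKillingOn_quad (hU : IsOpen U) {α : Fin n → ℝ} (hpos : n ≠ 3 → ∀ z ∈ U, 0 < quad α z) :
    IsKillingOn (flatMetric (Cn n)) U (twistedGrad (potential n (quad α))) := by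
  rw [quad_eq_hermPoly] at hpos ⊢
  exact isKillingOn_of_eqOn_potential_hermPoly hU hpos fun _ _ => rfl

theorem solvesOn_quad_iff (hn : 2 ≤ n) {α : Fin n → ℝ} (hα : α ≠ 0) (hU : IsOpen U)
    (hne : U.Nonempty) (hpos : n ≠ 3 → ∀ z ∈ U, 0 < quad α z) :
    SolvesOn U (potential n (quad α)) ↔ n = 2 ∧ ∀ i j, α i = α j := by
  rw [quad_eq_hermPoly] at hpos ⊢
  constructor
  · intro h
    rcases solvesOn_hermPoly_cases hn hU hne hpos h with h | ⟨h2, a, -, rfl, -⟩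
    · exact absurd h.1 hα
    · exact ⟨h2, fun _ _ => rfl⟩
  · rintro ⟨h2, h⟩
    obtain ⟨a, rfl⟩ : ∃ a, α = fun _ => a := ⟨α ⟨0, by omega⟩, funext fun i => h _ _⟩
    have ha : a ≠ 0 := fun h0 => hα (by ext; simp [h0])
    have := solvesOn_of_const (U := U) h2 (W := LinearIsometryEquiv.refl ℂ (Cn n)) ha (b := 0)
    simp only [norm_zero, ne_eq, OfNat.ofNat_ne_zero, not_false_eq_true, zero_pow, zero_div] at this
    exact this (hpos (by omega))

theorem killing_and_solvesOn_iff (hn : 2 ≤ n) (hU : IsOpen U) (hc : IsConnected U)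
    {γ : Cn n → ℝ} (hγ : ContDiffOn ℝ ∞ γ U) (hnc : ¬ ∃ c : ℝ, ∀ z ∈ U, γ z = c) :
    (IsKillingOn (flatMetric (Cn n)) U (twistedGrad γ) ∧ SolvesOn U γ) ↔
      n = 2 ∧ ∃ (a : Cn n) (α : ℝ), 0 < α ∧ a ∉ U ∧
        ∀ z ∈ U, γ z = potential n (fun z => quad (fun _ => α) (z - a)) z := by
  constructor
  · rintro ⟨hK, hS⟩
    obtain ⟨W, α, b, c, hpos, h⟩ := (isKillingOn_twistedGrad_iff hU hc hγ).1 hK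
    rw [SolvesOn.congr hU h] at hS
    rcases solvesOn_hermPoly_cases hn hU hc.nonempty hpos hS with
      ⟨rfl, rfl⟩ | ⟨h2, a, ha, rfl, rfl⟩
    · exact absurd ⟨potential n (fun _ => c) 0, fun z hz => by
        rw [h z hz]; simp [potential, hermPoly, quad]⟩ hnc
    · have h3 : n ≠ 3 := by omega
      have hpos' : ∀ z ∈ U, 0 < a / 2 * ‖z - (-(1 / a)) • b‖ ^ 2 := fun z hz => by
        have := hpos h3 z hz
        rwa [hermPoly_const_eq W ha, quad_const] at this
      -- Positivity of q on U gives both a > 0 and the absence from U of the centre, where q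
      -- vanishes.
      refine ⟨h2, (-(1 / a)) • b, a, ?_, fun hmem => ?_, fun z hz => ?_⟩
      · obtain ⟨z, hz⟩ := hc.nonempty
        have := pos_of_mul_pos_left (hpos' z hz) (sq_nonneg _)
        linarith
      · simpa using hpos' _ hmem
      · rw [h z hz]
        exact potential_congr (hermPoly_const_eq W ha b z)
  · rintro ⟨h2, a, α, hα, ha, h⟩
    have hq : (fun z => quad (fun _ => α) (z - a)) =
        hermPoly (LinearIsometryEquiv.refl ℂ (Cn n)) (fun _ => α) ((-α) • a)
          (‖(-α) • a‖ ^ 2 / (2 * α)) := by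
      ext z
      rw [hermPoly_const_eq _ hα.ne', smul_smul]
      congr 2
      field_simp
      simp
    have hpos : ∀ z ∈ U, 0 < quad (fun _ => α) (z - a) := fun z hz => by
      rw [quad_const]
      have : z - a ≠ 0 := sub_ne_zero.2 fun h0 => ha (h0 ▸ hz)
      positivity
    rw [SolvesOn.congr hU h]
    rw [hq] at h ⊢
    have hpos' : ∀ z ∈ U, 0 < hermPoly (LinearIsometryEquiv.refl ℂ (Cn n)) (fun _ => α) ((-α) • a)
          (‖(-α) • a‖ ^ 2 / (2 * α)) z := fun z hz => by rw [← hq]; exact hpos z hz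
    exact ⟨isKillingOn_of_eqOn_potential_hermPoly hU (fun _ => hpos') h,
      solvesOn_of_const h2 hα.ne' hpos'⟩

end MainFlat

/-! ### Traces with respect to a conformally flat metric. -/

section MetricTrace

variable {E : Type*} [NormedAddCommGroup E] [InnerProductSpace ℝ E] [FiniteDimensional ℝ E]
variable {F : Type*} [NormedAddCommGroup F] [NormedSpace ℝ F]

/-- A nondegenerate bilinear form on a finite-dimensional space is invertible. -/
theorem isInvertible_of_nondegenerate {F : Type*} [NormedAddCommGroup F] [NormedSpace ℝ F]
    [FiniteDimensional ℝ F] {B : F →L[ℝ] F →L[ℝ] ℝ} (hB : ∀ v, B v = 0 → v = 0) :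
    B.IsInvertible := by
  have hr : Module.finrank ℝ F = Module.finrank ℝ (F →L[ℝ] ℝ) := by
    rw [← (LinearMap.toContinuousLinearMap (𝕜 := ℝ) (E := F) (F' := ℝ)).finrank_eq]
    exact (Subspace.dual_finrank_eq (K := ℝ) (V := F)).symm
  have hinj : Function.Injective (B : F →ₗ[ℝ] F →L[ℝ] ℝ) :=
    (injective_iff_map_eq_zero _).2 hB
  exact ⟨(LinearEquiv.ofInjectiveOfFinrankEq (B : F →ₗ[ℝ] F →L[ℝ] ℝ) hinj
    hr).toContinuousLinearEquiv, by ext v; rfl⟩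

theorem flatMetric_apply {E : Type*} [NormedAddCommGroup E] [InnerProductSpace ℝ E] (x v w : E) : flatMetric E x v w = inner ℝ v w := rfl

theorem smul_flatMetric_isInvertible {c : ℝ} (hc : c ≠ 0) (x : E) :
    (c • flatMetric E x).IsInvertible := by
  refine isInvertible_of_nondegenerate fun v hv => ?_
  have := congrArg (fun L => L v) hv
  simpa [flatMetric_apply, hc] using this

theorem inner_inverse_smul_flatMetric {c : ℝ} (hc : c ≠ 0) (x : E) (L : E →L[ℝ] ℝ) (v : E) :
    inner ℝ ((c • flatMetric E x).inverse L) v = c⁻¹ * L v := by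
  obtain ⟨w, hw⟩ : ∃ w, (c • flatMetric E x).inverse L = w := ⟨_, rfl⟩
  rw [hw]
  rw [(smul_flatMetric_isInvertible hc x).inverse_apply_eq] at hw
  rw [hw]
  simp [hc, flatMetric_apply]

/-- The trace of a bilinear map for a metric conformal to the scalar product at a point. -/
theorem metricTrace_eq_sum {g : E → E →L[ℝ] E →L[ℝ] ℝ} {x : E} {c : ℝ} (hc : c ≠ 0)
    (hg : g x = c • flatMetric E x) {ι : Type*} [Fintype ι] (e : OrthonormalBasis ι ℝ E)
    (B : E →ₗ[ℝ] E →ₗ[ℝ] F) {B₀ : E → E → F} (hB : ∀ v w, B₀ v w = B v w) :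
    metricTrace g x B₀ = c⁻¹ • ∑ j, B (e j) (e j) := by
  set b := Module.finBasis ℝ E
  have h1 : ∀ i, (g x).inverse (LinearMap.toContinuousLinearMap (b.coord i)) =
      ∑ j, (c⁻¹ * b.coord i (e j)) • e j := fun i => by
    rw [hg]
    rw [← e.sum_repr' ((c • flatMetric E x).inverse _)]
    refine Finset.sum_congr rfl fun j _ => ?_
    rw [real_inner_comm, inner_inverse_smul_flatMetric hc]
    rfl
  simp only [metricTrace, hB]
  calc ∑ i, B (b i) ((g x).inverse (LinearMap.toContinuousLinearMap (b.coord i)))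
      = ∑ i, ∑ j, (c⁻¹ * b.coord i (e j)) • B (b i) (e j) := by
        simp only [h1, map_sum, map_smul]
    _ = ∑ j, c⁻¹ • B (∑ i, b.repr (e j) i • b i) (e j) := by
        rw [Finset.sum_comm]
        simp only [map_sum, map_smul, LinearMap.sum_apply, LinearMap.smul_apply, Finset.smul_sum,
          smul_smul, Module.Basis.coord_apply]
    _ = _ := by simp only [b.sum_repr, Finset.smul_sum]

/-- Both sums compute the same `metricTrace` of the flat metric, whose definition involves neither
basis. -/
theorem sum_orthonormalBasis_eq {ι ι' : Type*} [Fintype ι] [Fintype ι']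
    (e : OrthonormalBasis ι ℝ E) (e' : OrthonormalBasis ι' ℝ E) (B : E →ₗ[ℝ] E →ₗ[ℝ] F) :
    ∑ j, B (e j) (e j) = ∑ j, B (e' j) (e' j) := by
  have h1 := metricTrace_eq_sum (g := flatMetric E) (x := 0) (one_ne_zero (α := ℝ))
    (by simp) e B fun _ _ => rfl
  have h2 := metricTrace_eq_sum (g := flatMetric E) (x := 0) (one_ne_zero (α := ℝ))
    (by simp) e' B fun _ _ => rfl
  simpa using h1.symm.trans h2

end MetricTrace

/-! ### Christoffel symbols as smooth fields of bilinear maps. -/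

section Christoffel

variable {F : Type*} [NormedAddCommGroup F] [NormedSpace ℝ F]

/-- The Christoffel map as a continuous bilinear map. -/
noncomputable def christoffelCLM (h : F → F →L[ℝ] F →L[ℝ] ℝ) (y : F) : F →L[ℝ] F →L[ℝ] F :=
  ContinuousLinearMap.compL ℝ F (F →L[ℝ] ℝ) F (h y).inverse ∘L
    ((1 / 2 : ℝ) • (fderiv ℝ h y + (fderiv ℝ h y).flip -
      (ContinuousLinearMap.flipₗᵢ ℝ F F ℝ : (F →L[ℝ] F →L[ℝ] ℝ) →L[ℝ] (F →L[ℝ] F →L[ℝ] ℝ)) ∘L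
        (fderiv ℝ h y).flip))

/-- Differentiability is what allows the derivative of the scalar y ↦ h y v w to be read off from
that of h. -/
theorem christoffel_eq {h : F → F →L[ℝ] F →L[ℝ] ℝ} {y : F} (hd : DifferentiableAt ℝ h y)
    (v w : F) : christoffel h y v w = christoffelCLM h y v w := by
  have h1 : HasFDerivAt (fun y => h y v w) (((fderiv ℝ h y).flip v).flip w) y := by
    simpa using (hd.hasFDerivAt.clm_apply (hasFDerivAt_const v y)).clm_apply (hasFDerivAt_const w y)
  rw [christoffel, h1.fderiv]
  rfl

theorem christoffelCLM_symm {h : F → F →L[ℝ] F →L[ℝ] ℝ} {y : F} (hd : DifferentiableAt ℝ h y)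
    (hs : ∀ᶠ y' in nhds y, ∀ v w, h y' v w = h y' w v) (v w : F) :
    christoffelCLM h y v w = christoffelCLM h y w v := by
  rw [← christoffel_eq hd, ← christoffel_eq hd, christoffel, christoffel]
  have : (fun y => h y v w) =ᶠ[nhds y] fun y => h y w v := hs.mono fun y' h' => h' v w
  rw [this.fderiv_eq, add_comm (fderiv ℝ h y v w)]

theorem ContDiffAt.christoffelCLM [CompleteSpace F] {h : F → F →L[ℝ] F →L[ℝ] ℝ} {y : F}
    (hh : ContDiffAt ℝ ∞ h y) (hi : (h y).IsInvertible) :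
    ContDiffAt ℝ ∞ (christoffelCLM h) y := by
  unfold _root_.christoffelCLM
  have h1 : ContDiffAt ℝ ∞ (fderiv ℝ h) y := hh.fderiv_right (m := ∞) (by simp)
  have h2 : ContDiffAt ℝ ∞ (fun y => (h y).inverse) y := by
    obtain ⟨e, he⟩ := hi
    have := contDiffAt_map_inverse (n := ∞) (𝕜 := ℝ) e
    rw [he] at this
    exact this.comp y hh
  have h3 : ContDiffAt ℝ ∞ (fun y => (fderiv ℝ h y).flip) y :=
    (ContinuousLinearMap.flipₗᵢ ℝ F F (F →L[ℝ] ℝ)).contDiff.contDiffAt.comp y h1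
  have h4 : ContDiffAt ℝ ∞
      (fun y => ContinuousLinearMap.compL ℝ F (F →L[ℝ] ℝ) F (h y).inverse) y :=
    (ContinuousLinearMap.compL ℝ F (F →L[ℝ] ℝ) F).contDiff.contDiffAt.comp y h2
  exact h4.clm_comp (ContDiffAt.const_smul _ ((h1.add h3).sub (contDiffAt_const.clm_comp h3)))

end Christoffel

/-! ### Pull-back connections and the image of the position field. -/

section Connection

variable {E : Type*} [NormedAddCommGroup E] [NormedSpace ℝ E]
variable {F : Type*} [NormedAddCommGroup F] [NormedSpace ℝ F]

/-- The covariant derivative of a section `V` along `u`, for the connection with Christoffel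
map `Γ`. -/
noncomputable def covDerivAlong (Γ : F → F →L[ℝ] F →L[ℝ] F) (u V : E → F) (x : E) : E →L[ℝ] F :=
  fderiv ℝ V x + (Γ (u x)).flip (V x) ∘L fderiv ℝ u x

/-- The curvature of the connection with Christoffel map `Γ`. -/
noncomputable def connCurvature (Γ : F → F →L[ℝ] F →L[ℝ] F) (y a b c : F) : F :=
  fderiv ℝ Γ y a b c - fderiv ℝ Γ y b a c + Γ y a (Γ y b c) - Γ y b (Γ y a c)

variable {Γ : F → F →L[ℝ] F →L[ℝ] F} {u V : E → F} {x : E}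

theorem covDerivAlong_apply (v : E) :
    covDerivAlong Γ u V x v = fderiv ℝ V x v + Γ (u x) (fderiv ℝ u x v) (V x) := rfl

theorem Filter.EventuallyEq.covDerivAlong_eq {V' : E → F} (h : V =ᶠ[nhds x] V') :
    covDerivAlong Γ u V x = covDerivAlong Γ u V' x := by
  rw [covDerivAlong, covDerivAlong, h.fderiv_eq, h.eq_of_nhds]

theorem covDerivAlong_add {V' : E → F} (hV : DifferentiableAt ℝ V x)
    (hV' : DifferentiableAt ℝ V' x) :
    covDerivAlong Γ u (fun y => V y + V' y) x = covDerivAlong Γ u V x + covDerivAlong Γ u V' x := by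
  ext v
  simp only [covDerivAlong_apply, fderiv_fun_add hV hV', add_apply, map_add]
  abel

theorem covDerivAlong_sum {ι : Type*} {s : Finset ι} {V : ι → E → F}
    (hV : ∀ i, DifferentiableAt ℝ (V i) x) :
    covDerivAlong Γ u (fun y => ∑ i ∈ s, V i y) x = ∑ i ∈ s, covDerivAlong Γ u (V i) x := by
  ext v
  simp only [covDerivAlong_apply, fderiv_fun_sum fun i _ => hV i, sum_apply, map_sum,
    Finset.sum_add_distrib]

theorem covDerivAlong_smul {f : E → ℝ} (hf : DifferentiableAt ℝ f x) (hV : DifferentiableAt ℝ V x)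
    (v : E) : covDerivAlong Γ u (fun y => f y • V y) x v =
      fderiv ℝ f x v • V x + f x • covDerivAlong Γ u V x v := by
  simp only [covDerivAlong_apply, fderiv_fun_smul hf hV, add_apply, map_smul, smul_apply,
    smul_add, ContinuousLinearMap.smulRight_apply]
  abel

theorem ContDiffAt.covDerivAlong (hu : ContDiffAt ℝ ∞ u x) (hV : ContDiffAt ℝ ∞ V x)
    (hΓ : ContDiffAt ℝ ∞ Γ (u x)) : ContDiffAt ℝ ∞ (covDerivAlong Γ u V) x := by
  unfold _root_.covDerivAlong
  have h1 : ContDiffAt ℝ ∞ (fun x => (Γ (u x)).flip) x :=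
    (ContinuousLinearMap.flipₗᵢ ℝ F F F).contDiff.contDiffAt.comp x (hΓ.comp x hu)
  exact (hV.fderiv_right (m := ∞) (by simp)).add
    ((h1.clm_apply hV).clm_comp (hu.fderiv_right (m := ∞) (by simp)))

theorem ContDiffAt.covDerivAlong_const (hu : ContDiffAt ℝ ∞ u x) (hV : ContDiffAt ℝ ∞ V x)
    (hΓ : ContDiffAt ℝ ∞ Γ (u x)) (w : E) :
    ContDiffAt ℝ ∞ (fun y => _root_.covDerivAlong Γ u V y w) x :=
  (hu.covDerivAlong hV hΓ).clm_apply contDiffAt_const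

theorem ContDiffAt.fderiv_const (hu : ContDiffAt ℝ ∞ u x) (w : E) :
    ContDiffAt ℝ ∞ (fun y => fderiv ℝ u y w) x :=
  (hu.fderiv_right (m := ∞) (by simp)).clm_apply contDiffAt_const

theorem hasFDerivAt_fderiv_const (hu : ContDiffAt ℝ ∞ u x) (w : E) :
    HasFDerivAt (fun y => fderiv ℝ u y w) ((fderiv ℝ (fderiv ℝ u) x).flip w) x := by
  have hd := ((hu.fderiv_right (m := ∞) (by simp)).differentiableAt (by simp)).hasFDerivAt
  simpa using hd.clm_apply (hasFDerivAt_const w x)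

/-- The pull-back connection has no torsion. -/
theorem covDerivAlong_fderiv_symm (hu : ContDiffAt ℝ ∞ u x)
    (hs : ∀ a b, Γ (u x) a b = Γ (u x) b a) (v w : E) :
    covDerivAlong Γ u (fun y => fderiv ℝ u y w) x v =
      covDerivAlong Γ u (fun y => fderiv ℝ u y v) x w := by
  rw [covDerivAlong_apply, covDerivAlong_apply, hs, (hasFDerivAt_fderiv_const hu w).fderiv,
    (hasFDerivAt_fderiv_const hu v).fderiv]
  congr 1
  exact (hu.isSymmSndFDerivAt (by simpa using two_le_infty)).eq v w

/-- In this expansion, everything not symmetric in v and w is a curvature term; this is the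
computation behind the Ricci identity. -/
theorem covDerivAlong_covDerivAlong (hu : ContDiffAt ℝ ∞ u x) (hV : ContDiffAt ℝ ∞ V x)
    (hΓ : ContDiffAt ℝ ∞ Γ (u x)) (v w : E) :
    covDerivAlong Γ u (fun y => covDerivAlong Γ u V y w) x v =
      fderiv ℝ (fderiv ℝ V) x v w + fderiv ℝ Γ (u x) (fderiv ℝ u x v) (fderiv ℝ u x w) (V x)
      + Γ (u x) (fderiv ℝ (fderiv ℝ u) x v w) (V x)
      + Γ (u x) (fderiv ℝ u x w) (fderiv ℝ V x v)
      + Γ (u x) (fderiv ℝ u x v) (covDerivAlong Γ u V x w) := by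
  have h1 : HasFDerivAt (fun y => Γ (u y)) (fderiv ℝ Γ (u x) ∘L fderiv ℝ u x) x :=
    (hΓ.differentiableAt (by simp)).hasFDerivAt.comp x (hu.differentiableAt (by simp)).hasFDerivAt
  have h2 := (hasFDerivAt_fderiv_const hV w).add
    ((h1.clm_apply (hasFDerivAt_fderiv_const hu w)).clm_apply
      (hV.differentiableAt (by simp)).hasFDerivAt)
  have h3 : fderiv ℝ (fun y => covDerivAlong Γ u V y w) x = _ := h2.fderiv
  rw [covDerivAlong_apply, h3]
  simp only [add_apply, ContinuousLinearMap.flip_apply, ContinuousLinearMap.comp_apply]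
  abel

/-- The Ricci identity. -/
theorem covDerivAlong_comm (hu : ContDiffAt ℝ ∞ u x) (hV : ContDiffAt ℝ ∞ V x)
    (hΓ : ContDiffAt ℝ ∞ Γ (u x)) (v w : E) :
    covDerivAlong Γ u (fun y => covDerivAlong Γ u V y w) x v =
      covDerivAlong Γ u (fun y => covDerivAlong Γ u V y v) x w
        + connCurvature Γ (u x) (fderiv ℝ u x v) (fderiv ℝ u x w) (V x) := by
  rw [covDerivAlong_covDerivAlong hu hV hΓ, covDerivAlong_covDerivAlong hu hV hΓ, connCurvature,
    (hV.isSymmSndFDerivAt (by simpa using two_le_infty)).eq v w,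
    (hu.isSymmSndFDerivAt (by simpa using two_le_infty)).eq v w, covDerivAlong_apply,
    covDerivAlong_apply, map_add, map_add]
  abel

theorem connCurvature_swap (Γ : F → F →L[ℝ] F →L[ℝ] F) (y a b c : F) :
    connCurvature Γ y a b c = - connCurvature Γ y b a c := by
  simp only [connCurvature]; abel

/-- The image under `du` of the position vector field. -/
noncomputable def radialPush (u : E → F) (y : E) : F := fderiv ℝ u y y

theorem ContDiffAt.radialPush (hu : ContDiffAt ℝ ∞ u x) : ContDiffAt ℝ ∞ (radialPush u) x :=
  (hu.fderiv_right (m := ∞) (by simp)).clm_apply contDiffAt_id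

/-- The derivative of the position field in direction w is w, and the symmetry of ∇du moves w
inside. In the last term the direction x is frozen as a constant vector. -/
theorem covDerivAlong_radialPush (hu : ContDiffAt ℝ ∞ u x)
    (hs : ∀ a b, Γ (u x) a b = Γ (u x) b a) (w : E) :
    covDerivAlong Γ u (radialPush u) x w =
      fderiv ℝ u x w + covDerivAlong Γ u (fun y => fderiv ℝ u y w) x x := by
  have hd := ((hu.fderiv_right (m := ∞) (by simp)).differentiableAt (by simp)).hasFDerivAt
  have h1 : fderiv ℝ (radialPush u) x = _ := (hd.clm_apply (hasFDerivAt_id x)).fderiv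
  rw [covDerivAlong_fderiv_symm hu hs, covDerivAlong_apply, covDerivAlong_apply, h1,
    (hasFDerivAt_fderiv_const hu x).fderiv]
  simp [radialPush]
  abel

theorem covDerivAlong_covDerivAlong_radialPush (hu : ∀ᶠ y in nhds x, ContDiffAt ℝ ∞ u y)
    (hΓ : ContDiffAt ℝ ∞ Γ (u x)) (hs : ∀ᶠ y in nhds x, ∀ a b, Γ (u y) a b = Γ (u y) b a)
    (v w : E) :
    covDerivAlong Γ u (fun y => covDerivAlong Γ u (radialPush u) y w) x v =
      (2 : ℝ) • covDerivAlong Γ u (fun y => fderiv ℝ u y w) x v +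
        covDerivAlong Γ u (fun y => covDerivAlong Γ u (fun y' => fderiv ℝ u y' w) y x) x v := by
  have hux := hu.self_of_nhds
  set K := covDerivAlong Γ u (fun y' => fderiv ℝ u y' w) with hK
  have hKs : ContDiffAt ℝ ∞ K x := hux.covDerivAlong (hux.fderiv_const w) hΓ
  have hKd := (hKs.differentiableAt (by simp)).hasFDerivAt
  -- Writing y = x + (y - x) makes the direction constant, up to a term vanishing at x whose
  -- derivative there is K x; that gives the second copy of ∇du.
  have h1 : (fun y => covDerivAlong Γ u (radialPush u) y w) =ᶠ[nhds x]
      fun y => fderiv ℝ u y w + (K y x + K y (y - x)) := by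
    filter_upwards [hu, hs] with y hy hsy
    rw [covDerivAlong_radialPush hy hsy, ← map_add, add_sub_cancel]
  have h2 : HasFDerivAt (fun y => K y (y - x)) (K x) x := by
    simpa using hKd.clm_apply ((hasFDerivAt_id x).sub_const x)
  have h3 : DifferentiableAt ℝ (fun y => K y x) x :=
    (hKd.clm_apply (hasFDerivAt_const x x)).differentiableAt
  rw [h1.covDerivAlong_eq, covDerivAlong_add ((hux.fderiv_const w).differentiableAt (by simp))
    (h3.fun_add h2.differentiableAt), covDerivAlong_add h3 h2.differentiableAt]
  have h4 : covDerivAlong Γ u (fun y => K y (y - x)) x = K x := by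
    ext v; rw [covDerivAlong_apply, h2.fderiv]; simp
  rw [h4, two_smul]
  simp only [add_apply, hK]
  abel

end Connection

/-! ### The Jacobi equation for the image of the position field. -/

section Jacobi

variable {E : Type*} [NormedAddCommGroup E] [InnerProductSpace ℝ E]
variable {F : Type*} [NormedAddCommGroup F] [NormedSpace ℝ F]
variable {Γ : F → F →L[ℝ] F →L[ℝ] F} {u : E → F} {x : E}
variable {ι : Type*} [Fintype ι]

/-- The image of the position field under a harmonic map is a Jacobi field. -/
theorem jacobi_radialPush (e : OrthonormalBasis ι ℝ E) (hu : ∀ᶠ y in nhds x, ContDiffAt ℝ ∞ u y)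
    (hΓ : ContDiffAt ℝ ∞ Γ (u x)) (hs : ∀ᶠ y in nhds x, ∀ a b, Γ (u y) a b = Γ (u y) b a)
    (hh : ∀ᶠ y in nhds x, ∑ i, covDerivAlong Γ u (fun y' => fderiv ℝ u y' (e i)) y (e i) = 0) :
    ∑ i, covDerivAlong Γ u (fun y => covDerivAlong Γ u (radialPush u) y (e i)) x (e i) =
      - ∑ i, connCurvature Γ (u x) (radialPush u x) (fderiv ℝ u x (e i)) (fderiv ℝ u x (e i)) := by
  have hux := hu.self_of_nhds
  -- Exchanging the derivatives in directions e_i and x costs a curvature term; after summation the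
  -- rest is the derivative along x of the tension field, which vanishes near x.
  have h1 : ∀ i, covDerivAlong Γ u
      (fun y => covDerivAlong Γ u (fun y' => fderiv ℝ u y' (e i)) y x) x (e i) =
      covDerivAlong Γ u (fun y => covDerivAlong Γ u (fun y' => fderiv ℝ u y' (e i)) y (e i)) x x
      - connCurvature Γ (u x) (radialPush u x) (fderiv ℝ u x (e i)) (fderiv ℝ u x (e i)) := by
    intro i
    rw [covDerivAlong_comm hux (hux.fderiv_const _) hΓ, connCurvature_swap, ← sub_eq_add_neg]
    rfl
  simp only [covDerivAlong_covDerivAlong_radialPush hu hΓ hs, Finset.sum_add_distrib,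
    ← Finset.smul_sum, hh.self_of_nhds, smul_zero, zero_add, h1, Finset.sum_sub_distrib]
  have h2 : ∑ i, covDerivAlong Γ u
      (fun y => covDerivAlong Γ u (fun y' => fderiv ℝ u y' (e i)) y (e i)) x x = 0 := by
    rw [← sum_apply, ← covDerivAlong_sum fun i =>
      (hux.covDerivAlong_const (hux.fderiv_const _) hΓ (e i)).differentiableAt (by simp)]
    have h3 : (fun y => ∑ i, covDerivAlong Γ u (fun y' => fderiv ℝ u y' (e i)) y (e i))
        =ᶠ[nhds x] fun _ => 0 := hh
    rw [h3.covDerivAlong_eq]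
    simp [covDerivAlong_apply]
  rw [h2, zero_sub]

/-- The rough Laplacian of `-4 |y|² du(y)`. -/
theorem sum_covDerivAlong_smul_radialPush (e : OrthonormalBasis ι ℝ E)
    (hu : ∀ᶠ y in nhds x, ContDiffAt ℝ ∞ u y) (hΓ : ContDiffAt ℝ ∞ Γ (u x)) :
    ∑ i, covDerivAlong Γ u (fun y => covDerivAlong Γ u
        (fun y' => (-4 * ‖y'‖ ^ 2) • radialPush u y') y (e i)) x (e i) =
      (-8 * (Fintype.card ι : ℝ)) • radialPush u x
      + (-16 : ℝ) • covDerivAlong Γ u (radialPush u) x x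
      + (-4 * ‖x‖ ^ 2) • ∑ i, covDerivAlong Γ u
          (fun y => covDerivAlong Γ u (radialPush u) y (e i)) x (e i) := by
  have hux := hu.self_of_nhds
  have hf : ∀ y : E, HasFDerivAt (fun y : E => -4 * ‖y‖ ^ 2) ((-8 : ℝ) • innerSL ℝ y) y := fun y => by
    refine ((hasStrictFDerivAt_norm_sq y).hasFDerivAt.const_mul (-4 : ℝ)).congr_fderiv ?_
    ext v; simp; ring
  have hZ := hux.radialPush
  have hin : ∀ w : E, HasFDerivAt (fun y : E => -8 * inner ℝ y w) ((-8 : ℝ) • innerSL ℝ w) x := by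
    intro w
    refine (((hasFDerivAt_id x).inner ℝ (hasFDerivAt_const w x)).const_mul (-8 : ℝ)).congr_fderiv ?_
    ext v; simp [real_inner_comm]
  -- Product rule for fZ with f = -4|y|²: f has second derivative -8⟨w, w⟩, and the two cross terms
  -- -8⟨x, w⟩∇_w Z add up.
  have key : ∀ w, covDerivAlong Γ u (fun y => covDerivAlong Γ u
        (fun y' => (-4 * ‖y'‖ ^ 2) • radialPush u y') y w) x w =
      (-8 * inner ℝ w w) • radialPush u x
      + (-16 : ℝ) • (inner ℝ w x • covDerivAlong Γ u (radialPush u) x w)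
      + (-4 * ‖x‖ ^ 2) • covDerivAlong Γ u
          (fun y => covDerivAlong Γ u (radialPush u) y w) x w := by
    intro w
    have h1 : (fun y => covDerivAlong Γ u (fun y' => (-4 * ‖y'‖ ^ 2) • radialPush u y') y w)
        =ᶠ[nhds x] fun y => (-8 * inner ℝ y w) • radialPush u y +
          (-4 * ‖y‖ ^ 2) • covDerivAlong Γ u (radialPush u) y w := by
      filter_upwards [hu] with y hy
      rw [covDerivAlong_smul (hf y).differentiableAt (hy.radialPush.differentiableAt (by simp)),
        (hf y).fderiv]
      simp
    have hZd := hZ.differentiableAt (by simp)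
    have hcd := (hux.covDerivAlong_const hZ hΓ w).differentiableAt (by simp)
    rw [h1.covDerivAlong_eq, covDerivAlong_add ((hin w).differentiableAt.fun_smul hZd)
      ((hf x).differentiableAt.fun_smul hcd), add_apply,
      covDerivAlong_smul (hin w).differentiableAt hZd, covDerivAlong_smul (hf x).differentiableAt hcd,
      (hin w).fderiv, (hf x).fderiv]
    simp only [smul_apply, innerSL_apply_apply, smul_eq_mul, real_inner_comm x w, smul_smul]
    module
  simp only [key, Finset.sum_add_distrib, ← Finset.smul_sum, ← Finset.sum_smul]
  -- The sum of ⟨e_i, e_i⟩ is the dimension, and the sum of ⟨e_i, x⟩∇_{e_i}Z is ∇_x Z.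
  congr 3
  · simp [mul_comm]
  · simp only [← map_smul, ← map_sum]
    congr 1
    exact e.sum_repr' x

end Jacobi

/-! ### Holomorphic maps are harmonic for the flat metric. -/

section Holomorphic

variable {n : ℕ} {F : Type*} [NormedAddCommGroup F] [NormedSpace ℝ F]

/-- Multiplication by `i` as an isometry. -/
noncomputable def mulIEquiv (n : ℕ) : Cn n ≃ₗᵢ[ℂ] Cn n :=
  { LinearEquiv.smulOfNeZero ℂ (Cn n) Complex.I Complex.I_ne_zero with
    norm_map' := fun x => by
      change ‖Complex.I • x‖ = ‖x‖
      rw [norm_smul]; simp }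

theorem mulIEquiv_apply (z : Cn n) : mulIEquiv n z = Complex.I • z := rfl

/-- The right-hand side is visibly linear in w, which makes the bilinear maps needed for traces
available. -/
theorem covDerivAlong_clm_const {E : Type*} [NormedAddCommGroup E] [NormedSpace ℝ E]
    {Γ : F → F →L[ℝ] F →L[ℝ] F} {u : E → F} {x : E} {C : E → E →L[ℝ] F}
    (hC : DifferentiableAt ℝ C x) (v w : E) :
    covDerivAlong Γ u (fun y => C y w) x v =
      fderiv ℝ C x v w + Γ (u x) (fderiv ℝ u x v) (C x w) := by
  have h := hC.hasFDerivAt.clm_apply (hasFDerivAt_const w x)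
  rw [covDerivAlong_apply, h.fderiv]
  simp

theorem covDerivEndo_eq {h : F → F →L[ℝ] F →L[ℝ] ℝ} {A : F → F →L[ℝ] F} {y : F}
    (hd : DifferentiableAt ℝ h y) (v w : F) : covDerivEndo h A y v w =
      fderiv ℝ A y v w + christoffelCLM h y v (A y w) - A y (christoffelCLM h y v w) := by
  rw [covDerivEndo, christoffel_eq hd, christoffel_eq hd]

/-- Covariant differentiation of A² = -1. -/
theorem covDerivEndo_anticomm {h : F → F →L[ℝ] F →L[ℝ] ℝ} {A : F → F →L[ℝ] F} {y : F}
    (hd : DifferentiableAt ℝ h y) (hA : DifferentiableAt ℝ A y)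
    (hsq : ∀ᶠ y' in nhds y, ∀ v, A y' (A y' v) = -v) (v w : F) :
    covDerivEndo h A y v (A y w) = - A y (covDerivEndo h A y v w) := by
  have h1 : HasFDerivAt (fun y' => A y' w) ((fderiv ℝ A y).flip w) y := by
    simpa using hA.hasFDerivAt.clm_apply (hasFDerivAt_const w y)
  have h2 := hA.hasFDerivAt.clm_apply h1
  have h3 : (fun y' => A y' (A y' w)) =ᶠ[nhds y] fun _ => -w := hsq.mono fun y' hy => hy w
  have h4 := congrArg (fun L => L v)
    (h2.unique ((hasFDerivAt_const (-w) y).congr_of_eventuallyEq h3))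
  have h5 := hsq.self_of_nhds
  simp only [add_apply, ContinuousLinearMap.comp_apply, ContinuousLinearMap.flip_apply,
    zero_apply] at h4
  rw [covDerivEndo_eq hd, covDerivEndo_eq hd, h5, map_sub, map_add, h5, map_neg,
    ← sub_eq_zero, ← h4]
  abel

/-- A holomorphic map from a flat space into a `(1,2)`-symplectic manifold is harmonic. -/
theorem harmonic_of_holomorphic {h : F → F →L[ℝ] F →L[ℝ] ℝ} {A : F → F →L[ℝ] F}
    {u : Cn n → F} {x : Cn n} (hu : ContDiffAt ℝ ∞ u x)
    (hd : DifferentiableAt ℝ h (u x)) (hA : DifferentiableAt ℝ A (u x))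
    (hsq : ∀ᶠ y in nhds (u x), ∀ v, A y (A y v) = -v)
    (hs : ∀ a b, christoffelCLM h (u x) a b = christoffelCLM h (u x) b a)
    (hsymp : ∀ v w, covDerivEndo h A (u x) v w + covDerivEndo h A (u x) (A (u x) v) (A (u x) w) = 0)
    (hol : ∀ᶠ y in nhds x, ∀ v, fderiv ℝ u y (Complex.I • v) = A (u y) (fderiv ℝ u y v))
    {ι : Type*} [Fintype ι] (e : OrthonormalBasis ι ℝ (Cn n)) :
    ∑ i, covDerivAlong (christoffelCLM h) u (fun y => fderiv ℝ u y (e i)) x (e i) = 0 := by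
  set Γ := christoffelCLM h
  have hdu : DifferentiableAt ℝ (fderiv ℝ u) x :=
    (hu.fderiv_right (m := ∞) (by simp)).differentiableAt (by simp)
  let B : Cn n →ₗ[ℝ] Cn n →ₗ[ℝ] F := LinearMap.mk₂ ℝ
    (fun v w => covDerivAlong Γ u (fun y => fderiv ℝ u y w) x v)
    (fun v v' w => map_add _ _ _) (fun c v w => map_smul _ _ _)
    (fun v w w' => by simp only [covDerivAlong_clm_const hdu]; simp only [map_add]; abel)
    (fun c v w => by simp only [covDerivAlong_clm_const hdu]; simp only [map_smul, smul_add])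
  have hBs : ∀ v w, B v w = B w v := fun v w => covDerivAlong_fderiv_symm hu hs v w
  -- Covariant derivative of the identity du(i w) = A du(w).
  have hBI : ∀ v w, B v (Complex.I • w) =
      covDerivEndo h A (u x) (fderiv ℝ u x v) (fderiv ℝ u x w) + A (u x) (B v w) := by
    intro v w
    have h1 : HasFDerivAt (fun y => A (u y)) (fderiv ℝ A (u x) ∘L fderiv ℝ u x) x :=
      hA.hasFDerivAt.comp x (hu.differentiableAt (by simp)).hasFDerivAt
    have h2 := h1.clm_apply (hasFDerivAt_fderiv_const hu w)
    have h3 : (fun y => fderiv ℝ u y (Complex.I • w)) =ᶠ[nhds x]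
        fun y => A (u y) (fderiv ℝ u y w) := hol.mono fun y hy => hy w
    change covDerivAlong Γ u (fun y => fderiv ℝ u y (Complex.I • w)) x v =
      _ + A (u x) (covDerivAlong Γ u (fun y => fderiv ℝ u y w) x v)
    rw [h3.covDerivAlong_eq, covDerivAlong_apply, covDerivAlong_apply, h2.fderiv,
      covDerivEndo_eq hd, (hasFDerivAt_fderiv_const hu w).fderiv]
    simp only [add_apply, ContinuousLinearMap.comp_apply, ContinuousLinearMap.flip_apply, map_add]
    abel
  -- Applying `hBI` in both slots leaves the error N(Ja, a) + J N(a, a), which the (1,2)-symplectic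
  -- condition and anticommutation make zero.
  have hpt : ∀ v, B (Complex.I • v) (Complex.I • v) = - B v v := by
    intro v
    set a := fderiv ℝ u x v
    set J := A (u x)
    set N := covDerivEndo h A (u x)
    have hJ : ∀ b, J (J b) = -b := hsq.self_of_nhds
    have hN : ∀ b c, N b (J c) = - J (N b c) := covDerivEndo_anticomm hd hA hsq
    have h2 := hsymp a a
    have h3 : N (J a) a = - J (N a a) := by
      have h4 : N a a - J (N (J a) a) = 0 := by rw [sub_eq_add_neg, ← hN]; exact h2
      have h5 := congrArg J h4
      rw [map_sub, hJ, map_zero, sub_neg_eq_add] at h5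
      exact eq_neg_of_add_eq_zero_right h5
    rw [hBI, hBs, hBI, map_add, hJ, hol.self_of_nhds]
    change N (J a) a + (J (N a a) + _) = _
    rw [h3]; abel
  -- The frame i e_j is orthonormal too, so the trace equals its own negative; no adapted unitary
  -- frame is needed.
  have h1 := sum_orthonormalBasis_eq e (e.map (unitaryReal (mulIEquiv n))) B
  simp only [OrthonormalBasis.map_apply, unitaryReal_apply, mulIEquiv_apply, hpt,
    Finset.sum_neg_distrib] at h1
  rw [eq_neg_iff_add_eq_zero, ← two_smul ℝ] at h1
  exact (smul_eq_zero.1 h1).resolve_left two_ne_zero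

end Holomorphic

/-! ### The metric |z|⁻⁴ can. -/

section InvMetric

theorem hasFDerivAt_invMetric {x : Cn 2} (hx : x ≠ 0) :
    HasFDerivAt invMetric (((-4 * (‖x‖ ^ 6)⁻¹) • innerSL ℝ x).smulRight (flatMetric (Cn 2) 0)) x := by
  have h0 : ‖x‖ ≠ 0 := norm_ne_zero_iff.2 hx
  have h1 := (hasStrictFDerivAt_norm_sq x).hasFDerivAt.pow 2
  have h2 := (hasDerivAt_inv (x := (‖x‖ ^ 2) ^ 2) (by positivity)).comp_hasFDerivAt x h1
  have h3 := h2.smul_const (flatMetric (Cn 2) 0)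
  have h4 : invMetric = fun z : Cn 2 => ((fun y => y⁻¹) ∘ fun z : Cn 2 => (‖z‖ ^ 2) ^ 2) z •
      flatMetric (Cn 2) 0 := by
    ext1 z
    simp only [invMetric, Function.comp_apply, ← pow_mul]
    rfl
  rw [h4]
  refine h3.congr_fderiv ?_
  congr 1
  ext v
  simp
  field_simp
  ring

theorem invMetric_eq (x : Cn 2) : invMetric x = (‖x‖ ^ 4)⁻¹ • flatMetric (Cn 2) x := rfl

/-- This is dσ(v)w + dσ(w)v - ⟨v, w⟩ grad σ for the conformal metric e^{2σ} can with σ = -2 ln|x|.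
-/
theorem christoffel_invMetric {x : Cn 2} (hx : x ≠ 0) (v w : Cn 2) :
    christoffel invMetric x v w =
      (-(2 / ‖x‖ ^ 2)) • (inner ℝ x v • w + inner ℝ x w • v - inner ℝ v w • x) := by
  have h0 : ‖x‖ ≠ 0 := norm_ne_zero_iff.2 hx
  have hc : (‖x‖ ^ 4)⁻¹ ≠ 0 := by positivity
  have hd := hasFDerivAt_invMetric hx
  have h1 := (hd.clm_apply (hasFDerivAt_const v x)).clm_apply (hasFDerivAt_const w x)
  have h2 : fderiv ℝ (fun y => invMetric y v w) x = _ := h1.fderiv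
  rw [christoffel, h2, hd.fderiv, invMetric_eq,
    (smul_flatMetric_isInvertible hc x).inverse_apply_eq]
  ext t
  simp [flatMetric_apply]
  field_simp
  ring

/-- The trace is (2 - m) grad σ, with m = 4 and grad σ = -2x/|x|². -/
theorem sum_christoffel_invMetric {x : Cn 2} (hx : x ≠ 0) {ι : Type*} [Fintype ι]
    (e : OrthonormalBasis ι ℝ (Cn 2)) :
    ∑ i, christoffelCLM invMetric x (e i) (e i) = (4 / ‖x‖ ^ 2) • x := by
  have hcard : (Fintype.card ι : ℝ) = 4 := by
    have h1 : Module.finrank ℝ (Cn 2) = 4 := by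
      rw [finrank_real_of_complex]; simp
    rw [Module.finrank_eq_card_basis e.toBasis] at h1
    exact_mod_cast h1
  simp only [← christoffel_eq (hasFDerivAt_invMetric hx).differentiableAt,
    christoffel_invMetric hx, ← Finset.smul_sum, Finset.sum_sub_distrib, Finset.sum_add_distrib,
    ← Finset.sum_smul]
  have h2 : ∑ i, inner ℝ x (e i) • e i = x := by
    simp only [real_inner_comm _ x]; exact e.sum_repr' x
  rw [h2]
  simp only [real_inner_self_eq_norm_sq, e.norm_eq_one, Finset.sum_const, Finset.card_univ,
    nsmul_eq_mul, hcard]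
  module

theorem metricTrace_invMetric {F : Type*} [NormedAddCommGroup F] [NormedSpace ℝ F] {x : Cn 2}
    (hx : x ≠ 0) {ι : Type*} [Fintype ι] (e : OrthonormalBasis ι ℝ (Cn 2))
    (B : Cn 2 →ₗ[ℝ] Cn 2 →ₗ[ℝ] F) {B₀ : Cn 2 → Cn 2 → F} (hB : ∀ v w, B₀ v w = B v w) :
    metricTrace invMetric x B₀ = ‖x‖ ^ 4 • ∑ j, B (e j) (e j) := by
  have h0 : ‖x‖ ≠ 0 := norm_ne_zero_iff.2 hx
  rw [metricTrace_eq_sum (c := (‖x‖ ^ 4)⁻¹) (by positivity) (invMetric_eq x) e B hB, inv_inv]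

end InvMetric

/-! ### The bitension field for |z|⁻⁴ can. -/

section Bitension

variable {F : Type*} [NormedAddCommGroup F] [NormedSpace ℝ F]
variable {h : F → F →L[ℝ] F →L[ℝ] ℝ} {u : Cn 2 → F} {x : Cn 2}

theorem pullbackConn_eq {V : Cn 2 → F} (hd : DifferentiableAt ℝ h (u x)) (v : Cn 2) :
    pullbackConn h u V x v = covDerivAlong (christoffelCLM h) u V x v := by
  rw [pullbackConn, covDerivAlong_apply, christoffel_eq hd]

/-- The trace for `invMetric` of the second covariant derivative `∇²_{v,w} = ∇_v C w - C ∇_v w`. -/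
theorem metricTrace_invMetric_covDeriv (hx : x ≠ 0) (hd : DifferentiableAt ℝ h (u x))
    {C : Cn 2 → Cn 2 →L[ℝ] F} (hC : DifferentiableAt ℝ C x) {ι : Type*} [Fintype ι]
    (e : OrthonormalBasis ι ℝ (Cn 2)) :
    metricTrace invMetric x (fun v w => pullbackConn h u (fun y => C y w) x v
      - C x (christoffel invMetric x v w)) =
      ‖x‖ ^ 4 • (∑ i, covDerivAlong (christoffelCLM h) u (fun y => C y (e i)) x (e i)
        - C x ((4 / ‖x‖ ^ 2) • x)) := by
  let B : Cn 2 →ₗ[ℝ] Cn 2 →ₗ[ℝ] F := LinearMap.mk₂ ℝ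
    (fun v w => covDerivAlong (christoffelCLM h) u (fun y => C y w) x v
      - C x (christoffelCLM invMetric x v w))
    (fun v v' w => by simp only [map_add, add_apply]; abel)
    (fun c v w => by simp only [map_smul, smul_apply, smul_sub])
    (fun v w w' => by simp only [covDerivAlong_clm_const hC]; simp only [map_add]; abel)
    (fun c v w => by simp only [covDerivAlong_clm_const hC]; simp only [map_smul, smul_add, smul_sub])
  rw [metricTrace_invMetric hx e B fun v w => by
    rw [pullbackConn_eq hd, christoffel_eq (hasFDerivAt_invMetric hx).differentiableAt]; rfl]
  congr 1
  rw [← sum_christoffel_invMetric hx e, map_sum, ← Finset.sum_sub_distrib]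
  rfl

/-- The tension field, for `invMetric`, of a map which is harmonic for the flat metric. -/
theorem tension_invMetric (hx : x ≠ 0) (hd : DifferentiableAt ℝ h (u x))
    (hu : ContDiffAt ℝ ∞ u x) {ι : Type*} [Fintype ι] (e : OrthonormalBasis ι ℝ (Cn 2))
    (hh : ∑ i, covDerivAlong (christoffelCLM h) u (fun y => fderiv ℝ u y (e i)) x (e i) = 0) :
    tension invMetric h u x = (-4 * ‖x‖ ^ 2) • radialPush u x := by
  have h0 : ‖x‖ ≠ 0 := norm_ne_zero_iff.2 hx
  have := metricTrace_invMetric_covDeriv hx hd (C := fderiv ℝ u)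
    ((hu.fderiv_right (m := ∞) (by simp)).differentiableAt (by simp)) e
  rw [hh, zero_sub, map_smul, smul_neg, smul_smul, ← neg_smul] at this
  refine Eq.trans ?_ (this.trans ?_)
  · rfl
  · congr 1
    field_simp

theorem curvature_eq {y : F} (hd : ∀ᶠ y' in nhds y, DifferentiableAt ℝ h y')
    (hΓ : DifferentiableAt ℝ (christoffelCLM h) y) (a b c : F) :
    curvature h y a b c = connCurvature (christoffelCLM h) y a b c := by
  have h1 : ∀ b c, fderiv ℝ (fun y' => christoffel h y' b c) y =
      ((fderiv ℝ (christoffelCLM h) y).flip b).flip c := fun b c => by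
    have h2 : (fun y' => christoffel h y' b c) =ᶠ[nhds y] fun y' => christoffelCLM h y' b c :=
      hd.mono fun y' hy => christoffel_eq hy b c
    rw [h2.fderiv_eq]
    have h3 := (hΓ.hasFDerivAt.clm_apply (hasFDerivAt_const b y)).clm_apply (hasFDerivAt_const c y)
    rw [h3.fderiv]
    ext v; simp
  simp only [curvature, h1, christoffel_eq hd.self_of_nhds]
  rfl

/-- A map which is harmonic for the flat metric is biharmonic for `invMetric`. -/
theorem bitension_invMetric_eq_zero [CompleteSpace F] (hx : x ≠ 0) {T : Set F} (hT : IsOpen T)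
    (hux : u x ∈ T) (hsm : ∀ y ∈ T, ContDiffAt ℝ ∞ h y) (hinv : ∀ y ∈ T, (h y).IsInvertible)
    (hsym : ∀ y ∈ T, ∀ v w, h y v w = h y w v) (hu : ∀ᶠ y in nhds x, ContDiffAt ℝ ∞ u y)
    {ι : Type*} [Fintype ι] (e : OrthonormalBasis ι ℝ (Cn 2))
    (hh : ∀ᶠ y in nhds x,
      ∑ i, covDerivAlong (christoffelCLM h) u (fun y' => fderiv ℝ u y' (e i)) y (e i) = 0) :
    bitension invMetric h u x = 0 := by
  have h0 : ‖x‖ ≠ 0 := norm_ne_zero_iff.2 hx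
  set Γ := christoffelCLM h with hΓ_def
  have hd : ∀ y ∈ T, DifferentiableAt ℝ h y := fun y hy => (hsm y hy).differentiableAt (by simp)
  have hΓ : ContDiffAt ℝ ∞ Γ (u x) := (hsm _ hux).christoffelCLM (hinv _ hux)
  have huc := hu.self_of_nhds
  have huT : ∀ᶠ y in nhds x, u y ∈ T := huc.continuousAt (hT.mem_nhds hux)
  have hs : ∀ᶠ y in nhds x, ∀ a b, Γ (u y) a b = Γ (u y) b a := by
    filter_upwards [huT] with y hy a b
    exact christoffelCLM_symm (hd _ hy)
      (Filter.mem_of_superset (hT.mem_nhds hy) fun y' hy' => hsym y' hy') a b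
  have hcard : (Fintype.card ι : ℝ) = 4 := by
    have h1 : Module.finrank ℝ (Cn 2) = 4 := by
      rw [finrank_real_of_complex]; simp
    rw [Module.finrank_eq_card_basis e.toBasis] at h1
    exact_mod_cast h1
  have hne : ∀ᶠ y in nhds x, y ≠ 0 := isOpen_ne.mem_nhds hx
  set f : Cn 2 → ℝ := fun y => -4 * ‖y‖ ^ 2 with hf
  have hten : tension invMetric h u =ᶠ[nhds x] fun y => f y • radialPush u y := by
    filter_upwards [hne, huT, hu, hh] with y h1 h2 h3 h4
    exact tension_invMetric h1 (hd _ h2) h3 e h4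
  set V := tension invMetric h u with hV
  have hVs : ContDiffAt ℝ ∞ V x := by
    refine ContDiffAt.congr_of_eventuallyEq ?_ hten
    exact (contDiffAt_const.mul (contDiff_norm_sq ℝ).contDiffAt).smul huc.radialPush
  -- The formula for the tension field is to be differentiated twice, so it is needed near every
  -- point close to x.
  have hev : ∀ w, (fun y => covDerivAlong Γ u V y w) =ᶠ[nhds x]
      fun y => covDerivAlong Γ u (fun y' => f y' • radialPush u y') y w := fun w => by
    filter_upwards [hten.eventually_nhds] with y hy
    rw [Filter.EventuallyEq.covDerivAlong_eq hy]
  have hfd : HasFDerivAt f ((-8 : ℝ) • innerSL ℝ x) x := by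
    refine ((hasStrictFDerivAt_norm_sq x).hasFDerivAt.const_mul (-4 : ℝ)).congr_fderiv ?_
    ext v; simp; ring
  have hrough : roughLaplacian invMetric h u V x = ‖x‖ ^ 4 • ((-4 * ‖x‖ ^ 2) •
      ∑ i, covDerivAlong Γ u (fun y => covDerivAlong Γ u (radialPush u) y (e i)) x (e i)) := by
    have h1 := metricTrace_invMetric_covDeriv hx (hd _ hux) (C := covDerivAlong Γ u V)
      ((huc.covDerivAlong hVs hΓ).differentiableAt (by simp)) e
    have h2 : roughLaplacian invMetric h u V x = metricTrace invMetric x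
        (fun v w => pullbackConn h u (fun y => covDerivAlong Γ u V y w) x v
          - covDerivAlong Γ u V x (christoffel invMetric x v w)) := by
      unfold roughLaplacian
      congr 1
      ext v w
      rw [pullbackConn_eq (hd _ hux), pullbackConn_eq (hd _ hux), pullbackConn_eq (hd _ hux)]
      have h3 : (fun y => pullbackConn h u V y w) =ᶠ[nhds x] fun y => covDerivAlong Γ u V y w := by
        filter_upwards [huT] with y hy
        exact pullbackConn_eq (hd _ hy) w
      rw [h3.covDerivAlong_eq]
    rw [h2, h1]
    congr 1
    rw [Finset.sum_congr rfl fun i _ => by rw [(hev (e i)).covDerivAlong_eq],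
      sum_covDerivAlong_smul_radialPush e hu hΓ, hten.covDerivAlong_eq, hcard, map_smul,
      covDerivAlong_smul hfd.differentiableAt (huc.radialPush.differentiableAt (by simp)),
      hfd.fderiv]
    simp only [smul_apply, innerSL_apply_apply, real_inner_self_eq_norm_sq, smul_add, smul_smul,
      smul_eq_mul, hf]
    -- The direction 4x/|x|² applied to fZ gives -32Z - 16∇_x Z, the same as the lower-order terms
    -- -8·4 Z - 16∇_x Z of the flat Laplacian; the difference vanishes.
    have e1 : 4 / ‖x‖ ^ 2 * (-8 * ‖x‖ ^ 2) = -32 := by field_simp; norm_num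
    have e2 : 4 / ‖x‖ ^ 2 * (-4 * ‖x‖ ^ 2) = -16 := by field_simp; norm_num
    rw [e1, e2]
    module
  have hric : ricciAlong invMetric h u V x = ‖x‖ ^ 4 • ((-4 * ‖x‖ ^ 2) • ∑ i,
      connCurvature Γ (u x) (radialPush u x) (fderiv ℝ u x (e i)) (fderiv ℝ u x (e i))) := by
    let B : Cn 2 →ₗ[ℝ] Cn 2 →ₗ[ℝ] F := LinearMap.mk₂ ℝ
      (fun v w => connCurvature Γ (u x) (V x) (fderiv ℝ u x v) (fderiv ℝ u x w))
      (fun v v' w => by simp only [connCurvature, map_add, add_apply]; abel)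
      (fun c v w => by simp only [connCurvature, map_smul, smul_apply, smul_sub, smul_add])
      (fun v w w' => by simp only [connCurvature, map_add]; abel)
      (fun c v w => by simp only [connCurvature, map_smul, smul_sub, smul_add])
    have hdΓ : DifferentiableAt ℝ (christoffelCLM h) (u x) := hΓ.differentiableAt (by simp)
    rw [ricciAlong, metricTrace_invMetric hx e B fun v w =>
      curvature_eq (Filter.mem_of_superset (hT.mem_nhds hux) hd) hdΓ _ _ _]
    congr 1
    rw [Finset.smul_sum]
    refine Finset.sum_congr rfl fun i _ => ?_
    change connCurvature Γ (u x) (V x) _ _ = _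
    rw [hten.eq_of_nhds]
    simp only [connCurvature, map_smul, smul_apply, smul_sub, smul_add, hf]
  rw [bitension, hrough, hric, jacobi_radialPush e hu hΓ hs hh, smul_neg, smul_neg]
  exact neg_add_cancel _

end Bitension

/-! ### Chart expressions of the metric and the almost complex structure. -/

section Charts

variable {F : Type*} [NormedAddCommGroup F] [NormedSpace ℝ F]
variable {N : Type*} [TopologicalSpace N] [ChartedSpace F N] [IsManifold 𝓘(ℝ, F) ∞ N]
variable {e : OpenPartialHomeomorph N F}

theorem contMDiffAt_mfderiv_symm_apply (he : e ∈ atlas F N) {y : F} (hy : y ∈ e.target) (v : F) :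
    ContMDiffAt 𝓘(ℝ, F) (𝓘(ℝ, F).prod 𝓘(ℝ, F)) ∞ (fun y => Bundle.TotalSpace.mk' F
      (E := fun x : N => TangentSpace 𝓘(ℝ, F) x) (e.symm y)
        ((mfderiv 𝓘(ℝ, F) 𝓘(ℝ, F) e.symm y : F →L[ℝ] TangentSpace 𝓘(ℝ, F) (e.symm y)) v)) y := by
  have h1 : ContMDiffAt 𝓘(ℝ, F) 𝓘(ℝ, F) ∞ e.symm y :=
    contMDiffAt_symm_of_mem_maximalAtlas
      (IsManifold.subset_maximalAtlas he) hy
  have h2 := h1.mfderiv_const (m := ∞) (by simp)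
  refine ContMDiffAt.clm_apply_of_inCoordinates (IB₁ := 𝓘(ℝ, F))
    (IB₂ := 𝓘(ℝ, F)) (E₁ := fun x : F => TangentSpace 𝓘(ℝ, F) x)
    (b₁ := fun y : F => y) (F₁ := F) h2 (v := fun _ => v) ?_ h1
  exact (contMDiffAt_vectorSpace_iff_contDiffAt (𝕜 := ℝ) (E := F) (V := fun _ => v)).2
    contDiffAt_const

theorem contDiffAt_metric_apply
    (h : Bundle.ContMDiffRiemannianMetric 𝓘(ℝ, F) ∞ F (fun x : N => TangentSpace 𝓘(ℝ, F) x))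
    {b : F → N} {X Y : ∀ y, TangentSpace 𝓘(ℝ, F) (b y)} {y : F}
    (hb : ContMDiffAt 𝓘(ℝ, F) 𝓘(ℝ, F) ∞ b y)
    (hX : ContMDiffAt 𝓘(ℝ, F) (𝓘(ℝ, F).prod 𝓘(ℝ, F)) ∞ (fun y => Bundle.TotalSpace.mk' F
      (E := fun x : N => TangentSpace 𝓘(ℝ, F) x) (b y) (X y)) y)
    (hY : ContMDiffAt 𝓘(ℝ, F) (𝓘(ℝ, F).prod 𝓘(ℝ, F)) ∞ (fun y => Bundle.TotalSpace.mk' F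
      (E := fun x : N => TangentSpace 𝓘(ℝ, F) x) (b y) (Y y)) y) :
    ContDiffAt ℝ ∞ (fun y => h.inner (b y) (X y) (Y y)) y := by
  have : ContMDiffAt 𝓘(ℝ, F) (𝓘(ℝ, F).prod 𝓘(ℝ)) ∞
      (fun m ↦ Bundle.TotalSpace.mk' ℝ (E := Bundle.Trivial N ℝ) (b m)
        (h.inner (b m) (X m) (Y m))) y := by
    apply ContMDiffAt.clm_bundle_apply₂ (F₁ := F) (F₂ := F)
    · exact h.contMDiff.contMDiffAt.comp y hb
    · exact hX
    · exact hY
  rw [Bundle.contMDiffAt_totalSpace] at this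
  exact this.2.contDiffAt

theorem contDiffAt_clm_of_apply {D E G : Type*} [NormedAddCommGroup D] [NormedSpace ℝ D]
    [NormedAddCommGroup E] [NormedSpace ℝ E] [NormedAddCommGroup G] [NormedSpace ℝ G]
    [FiniteDimensional ℝ E] {f : D → E →L[ℝ] G} {x : D}
    (h : ∀ v, ContDiffAt ℝ ∞ (fun x => f x v) x) : ContDiffAt ℝ ∞ f x := by
  set b := Module.finBasis ℝ E
  have h1 : f = fun x => ∑ i, (ContinuousLinearMap.smulRightL ℝ E G
      (LinearMap.toContinuousLinearMap (b.coord i))) (f x (b i)) := by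
    ext x v
    have h2 := congrArg (f x) (b.sum_repr v)
    simp only [map_sum, map_smul] at h2
    simpa using h2.symm
  rw [h1]
  exact ContDiffAt.sum fun i _ => (ContinuousLinearMap.contDiff _).contDiffAt.comp x (h (b i))

theorem contDiffAt_chartMetric [FiniteDimensional ℝ F]
    (h : Bundle.ContMDiffRiemannianMetric 𝓘(ℝ, F) ∞ F (fun x : N => TangentSpace 𝓘(ℝ, F) x))
    (he : e ∈ atlas F N) {y : F} (hy : y ∈ e.target) : ContDiffAt ℝ ∞ (chartMetric h e) y := by
  have h1 : ContMDiffAt 𝓘(ℝ, F) 𝓘(ℝ, F) ∞ e.symm y :=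
    contMDiffAt_symm_of_mem_maximalAtlas (IsManifold.subset_maximalAtlas he) hy
  exact contDiffAt_clm_of_apply fun v => contDiffAt_clm_of_apply fun w =>
    contDiffAt_metric_apply h h1 (contMDiffAt_mfderiv_symm_apply he hy v)
      (contMDiffAt_mfderiv_symm_apply he hy w)

/-- The derivative of the inverse of a chart, as an endomorphism of the model space. -/
noncomputable def symmDeriv (e : OpenPartialHomeomorph N F) (y : F) : F →L[ℝ] F :=
  mfderiv 𝓘(ℝ, F) 𝓘(ℝ, F) e.symm y

/-- The derivative of a chart, as an endomorphism of the model space. -/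
noncomputable def chartDeriv (e : OpenPartialHomeomorph N F) (p : N) : F →L[ℝ] F :=
  mfderiv 𝓘(ℝ, F) 𝓘(ℝ, F) e p

theorem chartMetric_symm
    (h : Bundle.ContMDiffRiemannianMetric 𝓘(ℝ, F) ∞ F (fun x : N => TangentSpace 𝓘(ℝ, F) x))
    (y v w : F) : chartMetric h e y v w = chartMetric h e y w v :=
  h.symm (e.symm y) (symmDeriv e y v) (symmDeriv e y w)

theorem chartDeriv_symmDeriv (he : e ∈ atlas F N) {y : F} (hy : y ∈ e.target) (v : F) :
    chartDeriv e (e.symm y) (symmDeriv e y v) = v :=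
  congrArg (fun L : F →L[ℝ] F => L v)
    ((mdifferentiable_of_mem_atlas (I := 𝓘(ℝ, F)) he).comp_symm_deriv hy)

theorem symmDeriv_chartDeriv (he : e ∈ atlas F N) {p : N} (hp : p ∈ e.source) (v : F) :
    symmDeriv e (e p) (chartDeriv e p v) = v :=
  congrArg (fun L : F →L[ℝ] F => L v)
    ((mdifferentiable_of_mem_atlas (I := 𝓘(ℝ, F)) he).symm_comp_deriv hp)

theorem isInvertible_chartMetric [FiniteDimensional ℝ F]
    (h : Bundle.ContMDiffRiemannianMetric 𝓘(ℝ, F) ∞ F (fun x : N => TangentSpace 𝓘(ℝ, F) x))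
    (he : e ∈ atlas F N) {y : F} (hy : y ∈ e.target) : (chartMetric h e y).IsInvertible := by
  refine isInvertible_of_nondegenerate fun v hv => ?_
  by_contra hne
  have h1 : symmDeriv e y v ≠ 0 := fun h0 => hne (by
    rw [← chartDeriv_symmDeriv he hy v, h0, map_zero])
  have h2 := h.pos (e.symm y) (symmDeriv e y v) h1
  have h3 : chartMetric h e y v v = 0 := by rw [hv]; rfl
  exact h2.ne' h3

variable {J : ∀ x : N, TangentSpace 𝓘(ℝ, F) x →L[ℝ] TangentSpace 𝓘(ℝ, F) x}

theorem chartEndo_chartDeriv (he : e ∈ atlas F N) {p : N} (hp : p ∈ e.source) (ξ : F) :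
    chartEndo J e (e p) (chartDeriv e p ξ) = chartDeriv e p (J p ξ) := by
  -- The points e.symm (e p) and p are equal only propositionally, so the dependence of J on the
  -- base point is transported explicitly.
  have h1 : ∀ q, q = p → chartDeriv e q (J q ξ) = chartDeriv e p (J p ξ) := by
    rintro _ rfl; rfl
  refine Eq.trans ?_ (h1 (e.symm (e p)) (e.left_inv hp))
  change chartDeriv e (e.symm (e p)) (J (e.symm (e p))
    (symmDeriv e (e p) (chartDeriv e p ξ))) = _
  rw [symmDeriv_chartDeriv he hp]

/-- The inverse chart's derivative is injective, hence surjective in finite dimension, so a left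
inverse of it is also a right inverse. -/
theorem symmDeriv_chartEndo [FiniteDimensional ℝ F] (he : e ∈ atlas F N) {y : F}
    (hy : y ∈ e.target) (v : F) :
    symmDeriv e y (chartEndo J e y v) = J (e.symm y) (symmDeriv e y v) := by
  have hinj : Function.Injective (symmDeriv e y) :=
    Function.LeftInverse.injective (chartDeriv_symmDeriv he hy)
  have hsurj : Function.Surjective (symmDeriv e y : F →ₗ[ℝ] F) :=
    LinearMap.injective_iff_surjective.1 hinj
  obtain ⟨w, hw⟩ := hsurj (J (e.symm y) (symmDeriv e y v))
  have h1 : chartEndo J e y v = w := by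
    change chartDeriv e (e.symm y) (J (e.symm y) (symmDeriv e y v)) = w
    rw [← hw]
    exact chartDeriv_symmDeriv he hy w
  rw [h1]
  exact hw

theorem chartEndo_sq [FiniteDimensional ℝ F] (hJ : ∀ x v, J x (J x v) = -v) (he : e ∈ atlas F N)
    {y : F} (hy : y ∈ e.target) (v : F) : chartEndo J e y (chartEndo J e y v) = -v := by
  change chartDeriv e (e.symm y) (J (e.symm y) (symmDeriv e y (chartEndo J e y v))) = -v
  rw [symmDeriv_chartEndo he hy]
  refine (congrArg (chartDeriv e (e.symm y)) (hJ _ _)).trans ?_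
  refine (map_neg (chartDeriv e (e.symm y)) _).trans ?_
  exact congrArg _ (chartDeriv_symmDeriv he hy v)

theorem contDiffAt_chartEndo [FiniteDimensional ℝ F] (S : AlmostHermitian F N)
    (he : e ∈ atlas F N) {y : F} (hy : y ∈ e.target) : ContDiffAt ℝ ∞ (chartEndo S.J e) y := by
  have hb : ContMDiffAt 𝓘(ℝ, F) 𝓘(ℝ, F) ∞ e.symm y :=
    contMDiffAt_symm_of_mem_maximalAtlas (IsManifold.subset_maximalAtlas he) hy
  have hD := contMDiffAt_mfderiv_symm_apply he hy
  have hJD : ∀ v, ContMDiffAt 𝓘(ℝ, F) (𝓘(ℝ, F).prod 𝓘(ℝ, F)) ∞ (fun y => Bundle.TotalSpace.mk' F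
      (E := fun x : N => TangentSpace 𝓘(ℝ, F) x) (e.symm y)
        (S.J (e.symm y) (symmDeriv e y v))) y := fun v =>
    ContMDiffAt.clm_bundle_apply (F₁ := F) (F₂ := F) (S.contMDiff_J.contMDiffAt.comp y hb) (hD v)
  -- Pairing with the metric reduces smoothness of the endomorphism field to that of scalar
  -- functions h(JX, Y); the smooth inverse of the metric then raises the index.
  let K : F → F →L[ℝ] F →L[ℝ] ℝ := fun y => chartMetric S.metric e y ∘L chartEndo S.J e y
  have hK : ContDiffAt ℝ ∞ K y := by
    refine contDiffAt_clm_of_apply fun v => contDiffAt_clm_of_apply fun w => ?_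
    refine (contDiffAt_metric_apply S.metric hb (hJD v) (hD w)).congr_of_eventuallyEq ?_
    filter_upwards [e.open_target.mem_nhds hy] with y' hy'
    change S.metric.inner (e.symm y') (symmDeriv e y' (chartEndo S.J e y' v))
      (symmDeriv e y' w) = _
    rw [symmDeriv_chartEndo he hy']
    rfl
  have hM : ContDiffAt ℝ ∞ (fun y => (chartMetric S.metric e y).inverse) y := by
    obtain ⟨L, hL⟩ := isInvertible_chartMetric S.metric he hy
    have := contDiffAt_map_inverse (n := ∞) (𝕜 := ℝ) L
    rw [hL] at this
    exact this.comp y (contDiffAt_chartMetric S.metric he hy)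
  refine (hM.clm_comp hK).congr_of_eventuallyEq ?_
  filter_upwards [e.open_target.mem_nhds hy] with y' hy'
  ext v
  change _ = (chartMetric S.metric e y').inverse (chartMetric S.metric e y' (chartEndo S.J e y' v))
  exact ((isInvertible_chartMetric S.metric he hy').inverse_apply_eq.2 rfl).symm

end Charts

/-! ### Holomorphic maps into (1,2)-symplectic manifolds, and the final assembly. -/

section Biharmonic

variable {F : Type*} [NormedAddCommGroup F] [NormedSpace ℝ F] [FiniteDimensional ℝ F]
variable {N : Type*} [TopologicalSpace N] [ChartedSpace F N] [IsManifold 𝓘(ℝ, F) ∞ N]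

/-- Holomorphic maps from `(ℂ² ∖ {0}, |z|⁻⁴ can)` into `(1,2)`-symplectic manifolds are
biharmonic. -/
theorem isBiharmonicOn_of_holomorphic (S : AlmostHermitian F N) (hS : S.IsOneTwoSymplectic)
    {φ : Cn 2 → N} (hφ : IsHolomorphicMapOn S.J {z | z ≠ 0} φ) :
    IsBiharmonicOn invMetric {z | z ≠ 0} S.metric φ := by
  refine ⟨hφ.1, fun z hz e he hze => ?_⟩
  have := FiniteDimensional.complete ℝ F
  set u : Cn 2 → F := fun x => e (φ x) with hu_def
  have hopen : IsOpen {z : Cn 2 | z ≠ 0} := isOpen_ne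
  have hφs : ∀ x : Cn 2, x ≠ 0 → ContMDiffAt 𝓘(ℝ, Cn 2) 𝓘(ℝ, F) ∞ φ x := fun x hx =>
    hφ.1.contMDiffAt (hopen.mem_nhds hx)
  have hev : ∀ᶠ x in nhds z, x ≠ 0 ∧ φ x ∈ e.source :=
    Filter.Eventually.and (hopen.mem_nhds hz)
      ((hφs z hz).continuousAt (e.open_source.mem_nhds hze))
  have hes : ∀ p ∈ e.source, ContMDiffAt 𝓘(ℝ, F) 𝓘(ℝ, F) ∞ e p := fun p hp =>
    contMDiffAt_of_mem_maximalAtlas (IsManifold.subset_maximalAtlas he) hp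
  have hu : ∀ x : Cn 2, x ≠ 0 → φ x ∈ e.source → ContDiffAt ℝ ∞ u x := fun x hx hxe =>
    ((hes _ hxe).comp x (hφs x hx)).contDiffAt
  have hol : ∀ x : Cn 2, x ≠ 0 → φ x ∈ e.source → ∀ v,
      fderiv ℝ u x (Complex.I • v) = chartEndo S.J e (u x) (fderiv ℝ u x v) := by
    intro x hx hxe v
    let M : Cn 2 →L[ℝ] F := mfderiv 𝓘(ℝ, Cn 2) 𝓘(ℝ, F) φ x
    have h1 : fderiv ℝ u x = chartDeriv e (φ x) ∘L M := by
      rw [← mfderiv_eq_fderiv]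
      exact mfderiv_comp x ((hes _ hxe).mdifferentiableAt (by simp))
        ((hφs x hx).mdifferentiableAt (by simp))
    rw [h1]
    change chartDeriv e (φ x) (M (Complex.I • v)) =
      chartEndo S.J e (e (φ x)) (chartDeriv e (φ x) (M v))
    rw [chartEndo_chartDeriv he hxe]
    exact congrArg _ (hφ.2 x hx v)
  have hsm : ∀ y ∈ e.target, ContDiffAt ℝ ∞ (chartMetric S.metric e) y := fun y hy =>
    contDiffAt_chartMetric S.metric he hy
  refine bitension_invMetric_eq_zero hz e.open_target (e.map_source hze) hsm
    (fun y hy => isInvertible_chartMetric S.metric he hy)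
    (fun y _ => chartMetric_symm S.metric y) (hev.mono fun x hx => hu x hx.1 hx.2)
    (stdOrthonormalBasis ℝ (Cn 2)) ?_
  -- Harmonicity is required at all points near z, and at each of them holomorphy is required on a
  -- neighbourhood.
  filter_upwards [hev.eventually_nhds] with x hx
  obtain ⟨hx0, hxe⟩ := hx.self_of_nhds
  have hy := e.map_source hxe
  have hT := e.open_target.mem_nhds hy
  exact harmonic_of_holomorphic (hu x hx0 hxe) ((hsm _ hy).differentiableAt (by simp))
    ((contDiffAt_chartEndo S he hy).differentiableAt (by simp))
    (Filter.mem_of_superset hT fun y' hy' => chartEndo_sq S.J_sq he hy')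
    (christoffelCLM_symm ((hsm _ hy).differentiableAt (by simp))
      (Filter.Eventually.of_forall fun y' => chartMetric_symm S.metric y'))
    (hS e he _ hy) (hx.mono fun x' hx' => hol x' hx'.1 hx'.2) _

end Biharmonic

theorem mainTheorem8 :
    -- (1) the functions `γ` for which `J (e^{(n-3)γ} grad γ)` is a Killing vector field
    (∀ (n : ℕ) (U : Set (Cn n)), IsOpen U → IsConnected U →
      ∀ γ : Cn n → ℝ, ContDiffOn ℝ ∞ γ U →
        (IsKillingOn (flatMetric (Cn n)) U
            (twistedGrad γ) ↔
          ∃ (W : Cn n ≃ₗᵢ[ℂ] Cn n) (α : Fin n → ℝ)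
            (b : Cn n) (c : ℝ),
            (n ≠ 3 → ∀ z ∈ U, 0 < quad α (W z) + inner ℝ b z + c) ∧
            ∀ z ∈ U, γ z = potential n
              (fun z => quad α (W z) + inner ℝ b z + c) z)) ∧
    -- (2) the radial functions: the associated field is Killing, and they solve the equation
    -- only if `n = 2` and `α₁ = α₂`
    (∀ (n : ℕ), 2 ≤ n → ∀ α : Fin n → ℝ, α ≠ 0 →
      ∀ U : Set (Cn n), IsOpen U → U.Nonempty →
        (n ≠ 3 → ∀ z ∈ U, 0 < quad α z) →
        IsKillingOn (flatMetric (Cn n)) U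
            (twistedGrad
              (potential n (quad α))) ∧
        (SolvesOn U
            (potential n (quad α)) ↔
          n = 2 ∧ ∀ i j, α i = α j)) ∧
    -- (3) among all nonconstant functions as in (1), the solutions are, up to a translation,
    -- those of (2) with `n = 2` and `α₁ = α₂`
    (∀ (n : ℕ), 2 ≤ n → ∀ U : Set (Cn n), IsOpen U → IsConnected U →
      ∀ γ : Cn n → ℝ, ContDiffOn ℝ ∞ γ U →
        (¬ ∃ c : ℝ, ∀ z ∈ U, γ z = c) →
        ((IsKillingOn
              (flatMetric (Cn n)) U
              (twistedGrad γ) ∧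
            SolvesOn U γ) ↔
          n = 2 ∧ ∃ (a : Cn n) (α : ℝ), 0 < α ∧ a ∉ U ∧
            ∀ z ∈ U, γ z = potential n
              (fun z => quad (fun _ => α) (z - a)) z)) ∧
    -- (4) holomorphic maps from `(ℂ² ∖ {0}, |z|⁻⁴ can)` are biharmonic
    (∀ (F : Type*) [NormedAddCommGroup F] [NormedSpace ℝ F] [FiniteDimensional ℝ F]
      (N : Type*) [TopologicalSpace N] [ChartedSpace F N] [IsManifold 𝓘(ℝ, F) ∞ N]
      (S : AlmostHermitian F N), S.IsOneTwoSymplectic →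
        ∀ φ : Cn 2 → N,
          IsHolomorphicMapOn S.J {z | z ≠ 0} φ →
          IsBiharmonicOn invMetric {z | z ≠ 0}
            S.metric φ) := by
  -- `hermPoly` unfolds definitionally to the polynomial of the statement.
  refine ⟨fun n U hU hc γ hγ => isKillingOn_twistedGrad_iff hU hc hγ,
    fun n hn α hα U hU hne hpos => ⟨isKillingOn_quad hU hpos, solvesOn_quad_iff hn hα hU hne hpos⟩,
    fun n hn U hU hc γ hγ hnc => killing_and_solvesOn_iff hn hU hc hγ hnc, ?_⟩
  intro F _ _ _ N _ _ _ S hS φ hφ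
  exact isBiharmonicOn_of_holomorphic S hS hφ
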